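/- Let $n\ge 1$, $m\in\{0,\dots,n+1\}$ and $\hbar>0$. Let $Q$ be the set of $\lambda\in\mathbb R^n$ with pairwise distinct coordinates, all nonzero if $m\ge 1$, and let $\mu$ be the momenta conjugate to $\lambda$, with $\{f,g\}=\sum_i\left(\frac{\partial f}{\partial\lambda_i}\frac{\partial g}{\partial\mu_i}-\frac{\partial f}{\partial\mu_i}\frac{\partial g}{\partial\lambda_i}\right)$ on $T^*Q$. Put $\Delta_j=\prod_{k\ne j}(\lambda_j-\lambda_k)$ and $q_r=\rho_r(\lambda)=(-1)^r s_r(\lambda)$, where $s_r$ is the $r$-th elementary symmetric polynomial (so $q_0=1$). Equip $Q$ with the contravariant metric $G^{ij}=\frac{\lambda_i^m}{\Delta_i}\delta^{ij}$, let $g$ be the corresponding covariant metric and $|g|$ the absolute value of its determinant. For $r=1,\dots,n$ and $\alpha\in\mathbb Z$ let $$A_r^{ij}=-\frac{\partial\rho_r}{\partial\lambda_i}\frac{\lambda_i^m}{\Delta_i}\delta^{ij},\qquad V_r^{(\alpha)}=\sum_{j=1}^n\frac{\partial\rho_r}{\partial\lambda_j}\frac{\lambda_j^\alpha}{\Delta_j}.$$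 Let $J_1=0$ and, for $2\le r\le n$, $$J_r=\sum_{k=n+2-m-r}^{n-m}(n+1-m-k)\,q_{m+r-n-2+k}\frac{\partial}{\partial q_k}\quad\text{if } r\le n-m+1,$$ $$J_r=-\sum_{k=n+2-m}^{2n+2-m-r}(n+1-m-k)\,q_{m+r-n-2+k}\frac{\partial}{\partial q_k}\quad\text{if } r\ge n-m+2,$$ where $\frac{\partial}{\partial q_k}=-\sum_i\frac{\lambda_i^{n-k}}{\Delta_i}\frac{\partial}{\partial\lambda_i}$. Let $T\subseteq\mathbb R^n$ be an open set of times $t=(t_1,\dots,t_n)$ and let $c_\alpha:T\to\mathbb R$, $-m\le\alpha\le 2n-m+2$, be smooth. Define on $T^*Q$ the functions $$h_r^A=\tfrac12\sum_{i,j}A_r^{ij}\mu_i\mu_j+\sum_j J_r^j\mu_j+\sum_{\alpha=-m}^{2n-m+2}c_\alpha(t)V_r^{(\alpha)}$$ ($J_r^j$ being the components of $J_r$ in the coordinates $\lambda$) and let $$\hat h_r^A=-\tfrac12\hbar^2\sum_{k,j}|g|^{-1/2}\partial_k|g|^{1/2}A_r^{kj}\partial_j-\tfrac12 i\hbar\sum_j\left(|g|^{-1/2}\partial_j|g|^{1/2}J_r^j+J_r^j\partial_j\right)+\sum_{\alpha=-m}^{2n-m+2}c_\alpha(t)V_r^{(\alpha)},\qquad\partial_j=\frac{\partial}{\partial\lambda_j},$$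 be their minimal quantizations, as differential operators on $C^\infty(Q,\mathbb C)$. Put $\kappa_1=\left[\frac{n+3-m}2\right]$, $\kappa_2=\left[\frac m2\right]$ and $$H_r^A=\sum_{j=1}^r\zeta_{r,j}(t_1,\dots,t_{r-1})\,h_j^A\quad\text{for }\kappa_1<r\le \min(n,n-m+1),$$ $$H_r^A=\sum_{j=0}^{n-r}\zeta_{r,r+j}(t_{r+1},\dots,t_n)\,h_{r+j}^A\quad\text{for }\max(2,n-m+2)\le r\le n-\kappa_2,$$ and $H_r^A=h_r^A$ for all other $r\in\{1,\dots,n\}$, where the $\zeta$'s are smooth functions on $T$ depending only on the indicated times, with $\zeta_{r,r}=1$. Let $\hat H_r^A$ be given by the same formulas with every $h_j^A$ replaced by $\hat h_j^A$. If the functions $c_\alpha$ and $\zeta_{r,j}$ solve the system of PDEs of the classical construction, that is, if on $T\times T^*Q$ $$\frac{\partial H_r^A}{\partial t_s}-\frac{\partial H_s^A}{\partial t_r}+\{H_r^A,H_s^A\}=0,\qquad r,s=1,\dots,n,$$ then the $n$ operators $\hat H_r^A$ satisfy the quantum Frobenius condition $$i\hbar\frac{\partial\hat H_r^A}{\partial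 t_s}-i\hbar\frac{\partial\hat H_s^A}{\partial t_r}+[\hat H_r^A,\hat H_s^A]=0,\qquad r,s=1,\dots,n,$$ for all $t\in T$. Conversely, the quantum condition implies the classical one, so that both procedures lead to the same PDEs for $c_\alpha$ and $\zeta_{r,j}$. -/

import Mathlib

noncomputable section

namespace QuasiStackel

/-- Partial derivative with respect to the `i`-th coordinate of `ℝⁿ`. -/
def pd {n : ℕ} {F : Type*} [NormedAddCommGroup F] [NormedSpace ℝ F]
    (i : Fin n) (f : (Fin n → ℝ) → F) (x : Fin n → ℝ) : F :=
  fderiv ℝ f x (Pi.single i 1)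

/-! ### Minimal quantization on an open subset of `ℝⁿ` with metric `g` -/

/-- The density `|det g|^{1/2}` of a (covariant) metric tensor `g`. -/
def density {n : ℕ} (g : (Fin n → ℝ) → Matrix (Fin n) (Fin n) ℝ) (x : Fin n → ℝ) : ℝ :=
  Real.sqrt |(g x).det|

/-- Minimal quantization of `½ Σ C^{kj} p_k p_j`:
`-½ ħ² |g|^{-1/2} ∂_k |g|^{1/2} C^{kj} ∂_j`. -/
def quantQuadratic {n : ℕ} (ħ : ℝ) (g C : (Fin n → ℝ) → Matrix (Fin n) (Fin n) ℝ)
    (Ψ : (Fin n → ℝ) → ℂ) (x : Fin n → ℝ) : ℂ :=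
  -(1 / 2 : ℂ) * (ħ : ℂ) ^ 2 * (((density g x)⁻¹ : ℝ) : ℂ) *
    ∑ k : Fin n, pd k (fun z => ∑ j : Fin n, ((density g z * C z k j : ℝ) : ℂ) * pd j Ψ z) x

/-- Minimal quantization of `Σ X^j p_j`:
`-½ i ħ (|g|^{-1/2} ∂_j |g|^{1/2} X^j + X^j ∂_j)`. -/
def quantLinear {n : ℕ} (ħ : ℝ) (g : (Fin n → ℝ) → Matrix (Fin n) (Fin n) ℝ)
    (X : (Fin n → ℝ) → Fin n → ℝ) (Ψ : (Fin n → ℝ) → ℂ) (x : Fin n → ℝ) : ℂ :=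
  -(1 / 2 : ℂ) * Complex.I * (ħ : ℂ) *
    ((((density g x)⁻¹ : ℝ) : ℂ) *
        ∑ j : Fin n, pd j (fun z => ((density g z * X z j : ℝ) : ℂ) * Ψ z) x
      + ∑ j : Fin n, ((X x j : ℝ) : ℂ) * pd j Ψ x)

/-! ### Geometric objects in the separation coordinates `x = (λ₁, …, λₙ)`

The labels `r`, `k` below are the usual ones, running through `1, …, n`. -/

/-- `Δ_j = ∏_{k ≠ j} (λ_j - λ_k)`. -/
def delta {n : ℕ} (x : Fin n → ℝ) (j : Fin n) : ℝ :=
  ∏ k ∈ Finset.univ.erase j, (x j - x k)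

/-- The Viète coordinate `q_r = ρ_r(λ) = (-1)^r s_r(λ)`; thus `q_0 = 1` and `q_r = 0` for
`r > n`. -/
def viete {n : ℕ} (r : ℕ) (x : Fin n → ℝ) : ℝ :=
  (-1) ^ r * MvPolynomial.eval x (MvPolynomial.esymm (Fin n) ℝ r)

/-- The configuration space: the points at which the `λ_i` are distinct, and nonzero unless
`m = 0`. -/
def configSpace (n m : ℕ) : Set (Fin n → ℝ) :=
  {x | Function.Injective x ∧ (m ≠ 0 → ∀ i, x i ≠ 0)}

/-- The contravariant metric `G^{ij} = λ_i^m / Δ_i δ^{ij}`. -/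
def metricG {n : ℕ} (m : ℕ) (x : Fin n → ℝ) : Matrix (Fin n) (Fin n) ℝ :=
  Matrix.diagonal fun i => x i ^ m / delta x i

/-- The covariant metric. -/
def metricg {n : ℕ} (m : ℕ) (x : Fin n → ℝ) : Matrix (Fin n) (Fin n) ℝ :=
  (metricG m x)⁻¹

/-- The tensors `A_r^{ij} = -(∂ρ_r/∂λ_i) λ_i^m / Δ_i δ^{ij}`. -/
def tensorA {n : ℕ} (m r : ℕ) (x : Fin n → ℝ) : Matrix (Fin n) (Fin n) ℝ :=
  Matrix.diagonal fun i => -(pd i (viete r) x) * (x i ^ m / delta x i)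

/-- The basic separable potentials `V_r^{(α)} = Σ_j (∂ρ_r/∂λ_j) λ_j^α / Δ_j`. -/
def potV {n : ℕ} (r : ℕ) (α : ℤ) (x : Fin n → ℝ) : ℝ :=
  ∑ j : Fin n, pd j (viete r) x * (x j ^ α / delta x j)

/-- The component `J_r^k` of the vector field `J_r = Σ_k J_r^k ∂/∂q_k`: equal to
`(n+1-m-k) q_{m+r-n-2+k}` for `2 ≤ r ≤ n-m+1` and `n+2-m-r ≤ k ≤ n-m`, to
`-(n+1-m-k) q_{m+r-n-2+k}` for `r ≥ 2`, `n-m+2 ≤ r ≤ n` and `n+2-m ≤ k ≤ 2n+2-m-r`, and to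
zero otherwise; in particular `J_1 = 0`. -/
def vieteJ {n : ℕ} (m r k : ℕ) (x : Fin n → ℝ) : ℝ :=
  if 2 ≤ r ∧ r + m ≤ n + 1 ∧ n + 2 ≤ m + r + k ∧ k + m ≤ n then
    ((n : ℝ) + 1 - m - k) * viete (m + r + k - (n + 2)) x
  else if 2 ≤ r ∧ n + 2 ≤ r + m ∧ r ≤ n ∧ n + 2 ≤ k + m ∧ k + m + r ≤ 2 * n + 2 then
    -((n : ℝ) + 1 - m - k) * viete (m + r + k - (n + 2)) x
  else 0

/-- The vector field `J_r` in the coordinates `λ`, obtained from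
`∂/∂q_k = -Σ_i λ_i^{n-k} / Δ_i ∂/∂λ_i`. -/
def fieldJ {n : ℕ} (m r : ℕ) (x : Fin n → ℝ) (i : Fin n) : ℝ :=
  ∑ k ∈ Finset.Icc 1 n, vieteJ m r k x * -(x i ^ (n - k) / delta x i)

/-! ### Classical and quantum quasi-Stäckel Hamiltonians -/

/-- `h_r^A = E_r + W_r + Σ_α c_α(t) V_r^{(α)}` at time `t` and at the point `(x, y) = (λ, μ)` of
the phase space. -/
def hA {n : ℕ} (m : ℕ) (c : ℤ → (Fin n → ℝ) → ℝ) (t : Fin n → ℝ) (r : ℕ)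
    (x y : Fin n → ℝ) : ℝ :=
  (1 / 2) * ∑ i : Fin n, ∑ j : Fin n, tensorA m r x i j * y i * y j
    + ∑ i : Fin n, fieldJ m r x i * y i
    + ∑ α ∈ Finset.Icc (-(m : ℤ)) (2 * (n : ℤ) - m + 2), c α t * potV r α x

/-- `ĥ_r^A = Ê_r + Ŵ_r + Σ_α c_α(t) V_r^{(α)}`. -/
def hAhat {n : ℕ} (ħ : ℝ) (m : ℕ) (c : ℤ → (Fin n → ℝ) → ℝ) (t : Fin n → ℝ) (r : ℕ)
    (Ψ : (Fin n → ℝ) → ℂ) (x : Fin n → ℝ) : ℂ :=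
  quantQuadratic ħ (metricg m) (tensorA m r) Ψ x
    + quantLinear ħ (metricg m) (fieldJ m r) Ψ x
    + ((∑ α ∈ Finset.Icc (-(m : ℤ)) (2 * (n : ℤ) - m + 2), c α t * potV r α x : ℝ) : ℂ) * Ψ x

/-! ### The `ζ`-combinations -/

/-- `κ₁ = [(n+3-m)/2]`. -/
def kappa₁ (n m : ℕ) : ℕ := (n + 3 - m) / 2

/-- `κ₂ = [m/2]`. -/
def kappa₂ (m : ℕ) : ℕ := m / 2

/-- `Σ_{j=1}^r ζ_{r,j} h_j` for `κ₁ < r ≤ n-m+1`, `Σ_{j=0}^{n-r} ζ_{r,r+j} h_{r+j}` for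
`max(2, n-m+2) ≤ r ≤ n-κ₂`, and `h_r` for all other `r`. -/
def combine {n : ℕ} (m : ℕ) (ζ : ℕ → ℕ → (Fin n → ℝ) → ℝ) (t : Fin n → ℝ)
    {M : Type*} [AddCommGroup M] [Module ℝ M] (h : ℕ → M) (r : ℕ) : M :=
  if r = 1 ∨ r + m ≤ n + 1 then
    if r ≤ kappa₁ n m then h r
    else ∑ j ∈ Finset.Icc 1 r, ζ r j t • h j
  else
    if r ≤ n - kappa₂ m then ∑ j ∈ Finset.range (n - r + 1), ζ r (r + j) t • h (r + j)
    else h r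

/-- `f`, as a function on `T`, depends only on the times `t_k` whose label `k` satisfies `P`. -/
def DependsOnlyOn {n : ℕ} (T : Set (Fin n → ℝ)) (f : (Fin n → ℝ) → ℝ) (P : ℕ → Prop) : Prop :=
  ∀ t ∈ T, ∀ t' ∈ T, (∀ k : Fin n, P (k + 1) → t k = t' k) → f t = f t'

/-- The requirements on the coefficients `ζ` that occur in the combinations: smoothness,
`ζ_{r,r} = 1`, `ζ_{r,j} = ζ_{r,j}(t_1, …, t_{r-1})` in the first range of `r` and
`ζ_{r,r+j} = ζ_{r,r+j}(t_{r+1}, …, t_n)` in the second one. -/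
structure ZetaAdmissible {n : ℕ} (m : ℕ) (T : Set (Fin n → ℝ))
    (ζ : ℕ → ℕ → (Fin n → ℝ) → ℝ) : Prop where
  smooth₁ : ∀ r j, kappa₁ n m < r → r + m ≤ n + 1 → r ≤ n → 1 ≤ j → j ≤ r →
    ContDiffOn ℝ (⊤ : ℕ∞) (ζ r j) T
  depends₁ : ∀ r j, kappa₁ n m < r → r + m ≤ n + 1 → r ≤ n → 1 ≤ j → j ≤ r →
    DependsOnlyOn T (ζ r j) (fun k => k < r)
  diag₁ : ∀ r, kappa₁ n m < r → r + m ≤ n + 1 → r ≤ n → ∀ t ∈ T, ζ r r t = 1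
  smooth₂ : ∀ r j, 2 ≤ r → n + 2 ≤ r + m → r ≤ n - kappa₂ m → r ≤ j → j ≤ n →
    ContDiffOn ℝ (⊤ : ℕ∞) (ζ r j) T
  depends₂ : ∀ r j, 2 ≤ r → n + 2 ≤ r + m → r ≤ n - kappa₂ m → r ≤ j → j ≤ n →
    DependsOnlyOn T (ζ r j) (fun k => r < k)
  diag₂ : ∀ r, 2 ≤ r → n + 2 ≤ r + m → r ≤ n - kappa₂ m → ∀ t ∈ T, ζ r r t = 1

/-- The classical Hamiltonian `H_r^A`. -/
def HA {n : ℕ} (m : ℕ) (c : ℤ → (Fin n → ℝ) → ℝ) (ζ : ℕ → ℕ → (Fin n → ℝ) → ℝ)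
    (r : ℕ) (t : Fin n → ℝ) : (Fin n → ℝ) → (Fin n → ℝ) → ℝ :=
  combine m ζ t (hA m c t) r

/-- The quantum Hamiltonian `Ĥ_r^A`. -/
def HAhat {n : ℕ} (ħ : ℝ) (m : ℕ) (c : ℤ → (Fin n → ℝ) → ℝ) (ζ : ℕ → ℕ → (Fin n → ℝ) → ℝ)
    (r : ℕ) (t : Fin n → ℝ) : ((Fin n → ℝ) → ℂ) → (Fin n → ℝ) → ℂ :=
  combine m ζ t (hAhat ħ m c t) r

/-! ### Frobenius conditions -/

/-- The Poisson bracket of `Σ_i ∂/∂λ_i ∧ ∂/∂μ_i`. -/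
def poisson {n : ℕ} (f g : (Fin n → ℝ) → (Fin n → ℝ) → ℝ) (x y : Fin n → ℝ) : ℝ :=
  ∑ i : Fin n, (pd i (fun z => f z y) x * pd i (g x) y - pd i (f x) y * pd i (fun z => g z y) x)

/-- The classical Frobenius condition `∂H_r/∂t_s - ∂H_s/∂t_r + {H_r, H_s} = 0`, for times in `T`,
on the cotangent bundle of `Q`. The Hamiltonian labelled `r ∈ {1, …, n}` is `H r`, and the
element `r : Fin n` carries the label `r + 1`. -/
def ClassicalFrobenius {n : ℕ} (T Q : Set (Fin n → ℝ))
    (H : ℕ → (Fin n → ℝ) → (Fin n → ℝ) → (Fin n → ℝ) → ℝ) : Prop :=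
  ∀ r s : Fin n, ∀ t ∈ T, ∀ x ∈ Q, ∀ y : Fin n → ℝ,
    pd s (fun τ => H (r + 1) τ x y) t - pd r (fun τ => H (s + 1) τ x y) t
      + poisson (H (r + 1) t) (H (s + 1) t) x y = 0

/-- The quantum Frobenius condition `iħ ∂H_r/∂t_s - iħ ∂H_s/∂t_r + [H_r, H_s] = 0`, for times in
`T`, as an identity between differential operators acting on smooth functions on `Q`. -/
def QuantumFrobenius {n : ℕ} (ħ : ℝ) (T Q : Set (Fin n → ℝ))
    (H : ℕ → (Fin n → ℝ) → ((Fin n → ℝ) → ℂ) → (Fin n → ℝ) → ℂ) : Prop :=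
  ∀ r s : Fin n, ∀ t ∈ T, ∀ Ψ : (Fin n → ℝ) → ℂ, ContDiffOn ℝ (⊤ : ℕ∞) Ψ Q → ∀ x ∈ Q,
    Complex.I * (ħ : ℂ) * pd s (fun τ => H (r + 1) τ Ψ x) t
      - Complex.I * (ħ : ℂ) * pd r (fun τ => H (s + 1) τ Ψ x) t
      + (H (r + 1) t (H (s + 1) t Ψ) x - H (s + 1) t (H (r + 1) t Ψ) x) = 0

end QuasiStackel

end

open QuasiStackel

noncomputable section

namespace QuasiStackel

/-! For fixed `r`, `s`, `t` each Frobenius condition says that an expression of order at most two in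
the momenta vanishes, and the two expressions have the same coefficients up to nonzero constants.
Classically the bracket of two Hamiltonians, each the sum of a quadratic part `E`, a vector field
`J` and a potential `U`, could be cubic in the momenta. The cubic part is `{E, E'}`, which vanishes
because all quadratic parts come from one Stäckel matrix (`diagonal_symmetry`). A quadratic
polynomial is left, built from Lie derivatives of `E`, `J`, `U` along `J'` and conversely, from
gradients of the potentials, and from time derivatives.

Minimal quantization turns each of these brackets into a commutator with no correction of higher
order in `ħ`, for two reasons. The quadratic parts commute as operators: up to a constant factor,
the `r`-th one is `Σ_k S_{rk} L_k`, where `S` inverts the Stäckel matrix `λ_k^{n-r}` and `L_k` is an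
ordinary differential operator in `λ_k` alone (`stackel_operators_commute`, `diagonalOp_commute`,
`pd_stackelS_mul`). The fields `J_r` have divergence zero with respect to `|g|^{1/2}`
(`divergence_fieldJ`), so commuting with them yields exactly the quantized Lie derivative
(`opComm_fieldOp_diagonalOp`, `opComm_fieldOp_fieldOp`).

These facts combine in `commutator_formula`. Coefficients can be read off an operator
(`operator_eq_zero_iff`) just as off a polynomial (`quadratic_eq_zero_iff`), so both conditions
amount to `CoefficientCondition`, in which `ħ` does not occur.

The commutators are computed in an abstract algebra with `d_i = ∂_i` and `δ_i = ∂_i + ∂_i log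
|g|^{1/2}`, realized on the ring of smooth complex functions on `Q`. The functions `ζ` and `c` enter
only as weights of a linear combination, and a time derivative only changes the weights. -/

/-! ### Commutators -/

section Commutator

variable {A : Type*} [Ring A]

/-- The commutator in a ring. -/
def opComm (a b : A) : A := a * b - b * a

lemma opComm_mul (a b c : A) : opComm a (b * c) = opComm a b * c + b * opComm a c := by
  simp only [opComm]; noncomm_ring

lemma mul_opComm (a b c : A) : opComm (a * b) c = a * opComm b c + opComm a c * b := by
  simp only [opComm]; noncomm_ring

lemma opComm_skew (a b : A) : -opComm b a = opComm a b := by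
  simp only [opComm]; noncomm_ring

lemma opComm_add (a b c : A) : opComm a (b + c) = opComm a b + opComm a c := by
  simp only [opComm]; noncomm_ring

lemma add_opComm (a b c : A) : opComm (a + b) c = opComm a c + opComm b c := by
  simp only [opComm]; noncomm_ring

lemma sub_opComm (a b c : A) : opComm (a - b) c = opComm a c - opComm b c := by
  simp only [opComm]; noncomm_ring

lemma neg_opComm (a b : A) : opComm (-a) b = -opComm a b := by
  simp only [opComm]; noncomm_ring

lemma zero_opComm (a : A) : opComm 0 a = 0 := by
  simp [opComm]

lemma opComm_sum {κ : Type*} (s : Finset κ) (a : A) (f : κ → A) :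
    opComm a (∑ k ∈ s, f k) = ∑ k ∈ s, opComm a (f k) := by
  simp only [opComm, Finset.mul_sum, Finset.sum_mul, Finset.sum_sub_distrib]

lemma sum_opComm {κ : Type*} (s : Finset κ) (f : κ → A) (a : A) :
    opComm (∑ k ∈ s, f k) a = ∑ k ∈ s, opComm (f k) a := by
  simp only [opComm, Finset.mul_sum, Finset.sum_mul, Finset.sum_sub_distrib]

lemma smul_opComm [Algebra ℂ A] (c : ℂ) (a b : A) : opComm (c • a) b = c • opComm a b := by
  simp [opComm, smul_sub]

lemma opComm_smul [Algebra ℂ A] (c : ℂ) (a b : A) : opComm a (c • b) = c • opComm a b := by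
  simp [opComm, smul_sub]

end Commutator

/-! ### Operators built from commuting derivations -/

section Operators

variable {ι R A : Type*} [Fintype ι] [CommRing R] [Algebra ℂ R] [Ring A] [Algebra ℂ A]

/-- An algebra `A` of operators in which the functions act through `M`, and two families of
first-order operators `d_i = ∂_i` and `δ_i = ρ⁻¹ ∂_i ρ` that satisfy the usual relations. -/
structure IsCalculus (M : R →ₐ[ℂ] A) (δ d : ι → A) (D : ι → Derivation ℂ R R) : Prop where
  injective : Function.Injective M
  d_fun : ∀ i f, opComm (d i) (M f) = M (D i f)
  δ_fun : ∀ i f, opComm (δ i) (M f) = M (D i f)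
  d_d : ∀ i j, opComm (d i) (d j) = 0
  δ_δ : ∀ i j, opComm (δ i) (δ j) = 0

lemma opComm_map_map (M : R →ₐ[ℂ] A) (f g : R) : opComm (M f) (M g) = 0 := by
  rw [opComm, ← map_mul, ← map_mul, mul_comm, sub_self]

lemma map_commute (M : R →ₐ[ℂ] A) (f g : R) : M f * M g = M g * M f := by
  rw [← map_mul, ← map_mul, mul_comm]

/-- `Σ_{ij} δ_i B_{ij} d_j`. -/
def secondOrderOp (M : R →ₐ[ℂ] A) (δ d : ι → A) (B : ι → ι → R) : A :=
  ∑ i, ∑ j, δ i * M (B i j) * d j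

/-- `Σ_i δ_i a_i d_i`. -/
def diagonalOp (M : R →ₐ[ℂ] A) (δ d : ι → A) (a : ι → R) : A :=
  ∑ i, δ i * M (a i) * d i

/-- `Σ_i (δ_i Z_i + Z_i d_i)`. -/
def firstOrderOp (M : R →ₐ[ℂ] A) (δ d : ι → A) (Z : ι → R) : A :=
  ∑ i, (δ i * M (Z i) + M (Z i) * d i)

/-- The vector field `Σ_i X_i ∂_i` as an operator. -/
def fieldOp (M : R →ₐ[ℂ] A) (d : ι → A) (X : ι → R) : A := ∑ i, M (X i) * d i

/-- The vector field `Σ_i X_i ∂_i` applied to a function. -/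
def fieldDeriv (D : ι → Derivation ℂ R R) (X : ι → R) (f : R) : R := ∑ i, X i * D i f

/-- `X` is divergence free: `Σ_i X_i d_i = Σ_i δ_i X_i`. -/
def IsDivFree (M : R →ₐ[ℂ] A) (δ d : ι → A) (X : ι → R) : Prop :=
  fieldOp M d X = ∑ i, δ i * M (X i)

variable {M : R →ₐ[ℂ] A} {δ d : ι → A} {D : ι → Derivation ℂ R R}

lemma secondOrderOp_add (B B' : ι → ι → R) :
    secondOrderOp M δ d (B + B') = secondOrderOp M δ d B + secondOrderOp M δ d B' := by
  simp [secondOrderOp, mul_add, add_mul, Finset.sum_add_distrib]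

lemma secondOrderOp_sub (B B' : ι → ι → R) :
    secondOrderOp M δ d (B - B') = secondOrderOp M δ d B - secondOrderOp M δ d B' := by
  simp [secondOrderOp, mul_sub, sub_mul, Finset.sum_sub_distrib]

lemma firstOrderOp_add (Z Z' : ι → R) :
    firstOrderOp M δ d (Z + Z') = firstOrderOp M δ d Z + firstOrderOp M δ d Z' := by
  simp only [firstOrderOp, Pi.add_apply, map_add, mul_add, add_mul, Finset.sum_add_distrib]
  abel

lemma firstOrderOp_sub (Z Z' : ι → R) :
    firstOrderOp M δ d (Z - Z') = firstOrderOp M δ d Z - firstOrderOp M δ d Z' := by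
  simp only [firstOrderOp, Pi.sub_apply, map_sub, mul_sub, sub_mul, Finset.sum_add_distrib,
    Finset.sum_sub_distrib]
  abel

lemma secondOrderOp_diagonal [DecidableEq ι] (a : ι → R) :
    secondOrderOp M δ d (fun i j => if i = j then a i else 0) = diagonalOp M δ d a := by
  simp only [secondOrderOp, diagonalOp]
  refine Finset.sum_congr rfl fun i _ => ?_
  rw [Finset.sum_eq_single i]
  · simp
  · intro j _ hj
    simp [hj.symm]
  · simp

lemma diagonalOp_sum_smul {κ : Type*} (s : Finset κ) (c : κ → ℂ) (a : κ → ι → R) :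
    diagonalOp M δ d (fun i => ∑ j ∈ s, c j • a j i) = ∑ j ∈ s, c j • diagonalOp M δ d (a j) := by
  simp only [diagonalOp, map_sum, map_smul, Finset.mul_sum, Finset.sum_mul, mul_smul_comm,
    smul_mul_assoc, Finset.smul_sum]
  exact Finset.sum_comm

lemma firstOrderOp_sum_smul {κ : Type*} (s : Finset κ) (c : κ → ℂ) (Z : κ → ι → R) :
    firstOrderOp M δ d (fun i => ∑ j ∈ s, c j • Z j i)
      = ∑ j ∈ s, c j • firstOrderOp M δ d (Z j) := by
  simp only [firstOrderOp, map_sum, map_smul, Finset.mul_sum, Finset.sum_mul, mul_smul_comm,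
    smul_mul_assoc, Finset.smul_sum, smul_add, ← Finset.sum_add_distrib]
  exact Finset.sum_comm

lemma opComm_fieldOp_map (H : IsCalculus M δ d D) (X : ι → R) (f : R) :
    opComm (fieldOp M d X) (M f) = M (fieldDeriv D X f) := by
  simp only [fieldDeriv, fieldOp, sum_opComm, mul_opComm, opComm_map_map, zero_mul, add_zero,
    H.d_fun, map_sum, map_mul]

lemma firstOrderOp_eq_fieldOp {X : ι → R} (hX : IsDivFree M δ d X) :
    firstOrderOp M δ d X = (2 : ℂ) • fieldOp M d X := by
  rw [firstOrderOp, Finset.sum_add_distrib, ← hX, two_smul]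
  rfl

lemma opComm_fieldOp_d (H : IsCalculus M δ d D) (X : ι → R) (i : ι) :
    opComm (fieldOp M d X) (d i) = -∑ k, M (D i (X k)) * d k := by
  simp only [fieldOp, sum_opComm, mul_opComm, H.d_d, mul_zero, zero_add]
  rw [← Finset.sum_neg_distrib]
  refine Finset.sum_congr rfl fun k _ => ?_
  rw [← opComm_skew, H.d_fun, neg_mul]

/-- Zero divergence allows the field to be written with every `δ_k` on the left, so that only
commutators among the `δ`'s arise; commutators of a `δ` with a `d` are never needed. -/
lemma opComm_fieldOp_δ (H : IsCalculus M δ d D) {X : ι → R} (hX : IsDivFree M δ d X) (i : ι) :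
    opComm (fieldOp M d X) (δ i) = -∑ k, δ k * M (D i (X k)) := by
  rw [hX]
  simp only [sum_opComm, mul_opComm, H.δ_δ, zero_mul, add_zero]
  rw [← Finset.sum_neg_distrib]
  refine Finset.sum_congr rfl fun k _ => ?_
  rw [← opComm_skew, H.δ_fun, mul_neg]

/-- The coefficients form the Lie derivative along `X` of the diagonal contravariant tensor `a`. No
lower-order term appears: passing `X` through `d_i` leaves derivatives on the right, and passing it
through `δ_i` leaves them on the left, which is the ordering of `secondOrderOp`. -/
lemma opComm_fieldOp_diagonalOp [DecidableEq ι] (H : IsCalculus M δ d D)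
    {X : ι → R} (hX : IsDivFree M δ d X) (a : ι → R) :
    opComm (fieldOp M d X) (diagonalOp M δ d a) = secondOrderOp M δ d (fun i j =>
      (if i = j then fieldDeriv D X (a i) else 0) - (a j * D j (X i) + a i * D i (X j))) := by
  have e : (fun i j => (if i = j then fieldDeriv D X (a i) else 0)
        - (a j * D j (X i) + a i * D i (X j)))
      = (fun i j => if i = j then fieldDeriv D X (a i) else 0)
        - ((fun i j => a j * D j (X i)) + fun i j => a i * D i (X j)) := rfl
  rw [e, secondOrderOp_sub, secondOrderOp_add, secondOrderOp_diagonal]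
  simp only [diagonalOp, opComm_sum, opComm_mul, opComm_fieldOp_map H, opComm_fieldOp_d H,
    opComm_fieldOp_δ H hX, add_mul, Finset.sum_add_distrib]
  have e1 : ∑ i, -(∑ k, δ k * M (D i (X k))) * M (a i) * d i
      = -secondOrderOp M δ d fun i j => a j * D j (X i) := by
    rw [secondOrderOp, Finset.sum_comm, ← Finset.sum_neg_distrib]
    refine Finset.sum_congr rfl fun i _ => ?_
    rw [neg_mul, neg_mul, Finset.sum_mul, Finset.sum_mul]
    congr 1
    refine Finset.sum_congr rfl fun k _ => ?_
    rw [mul_comm (a i), map_mul]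
    noncomm_ring
  have e2 : ∑ i, δ i * M (a i) * -∑ k, M (D i (X k)) * d k
      = -secondOrderOp M δ d fun i j => a i * D i (X j) := by
    rw [secondOrderOp, ← Finset.sum_neg_distrib]
    refine Finset.sum_congr rfl fun i _ => ?_
    rw [mul_neg, Finset.mul_sum]
    congr 1
    refine Finset.sum_congr rfl fun k _ => ?_
    rw [map_mul]
    noncomm_ring
  rw [e1, e2]
  abel

/-- The Lie bracket of divergence-free fields is divergence free. The commutator is found once with
the coefficients left of the `d_i` and once with them right of the `δ_i`; adding both gives the
symmetric ordering. -/
lemma opComm_fieldOp_fieldOp (H : IsCalculus M δ d D)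
    {X Y : ι → R} (hX : IsDivFree M δ d X) (hY : IsDivFree M δ d Y) :
    (2 : ℂ) • opComm (fieldOp M d X) (fieldOp M d Y)
      = firstOrderOp M δ d fun i => fieldDeriv D X (Y i) - fieldDeriv D Y (X i) := by
  have e1 : opComm (fieldOp M d X) (fieldOp M d Y)
      = ∑ i, M (fieldDeriv D X (Y i) - fieldDeriv D Y (X i)) * d i := by
    conv_lhs => rw [show fieldOp M d Y = ∑ i, M (Y i) * d i from rfl]
    simp only [opComm_sum, opComm_mul, opComm_fieldOp_map H, opComm_fieldOp_d H,
      Finset.sum_add_distrib, sub_eq_add_neg, mul_neg,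
      Finset.sum_neg_distrib, Finset.mul_sum, map_add, map_neg, add_mul, neg_mul]
    congr 2
    rw [Finset.sum_comm]
    refine Finset.sum_congr rfl fun i _ => ?_
    simp only [fieldDeriv, map_sum, map_mul, Finset.sum_mul, mul_assoc]
  have e2 : opComm (fieldOp M d X) (fieldOp M d Y)
      = ∑ i, δ i * M (fieldDeriv D X (Y i) - fieldDeriv D Y (X i)) := by
    conv_lhs => rw [hY]
    simp only [opComm_sum, opComm_mul, opComm_fieldOp_map H, opComm_fieldOp_δ H hX,
      Finset.sum_add_distrib, sub_eq_add_neg, map_add, map_neg,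
      Finset.sum_neg_distrib, Finset.sum_mul, neg_mul, mul_add, mul_neg]
    rw [add_comm]
    congr 2
    rw [Finset.sum_comm]
    refine Finset.sum_congr rfl fun i _ => ?_
    simp only [fieldDeriv, map_sum, map_mul, Finset.mul_sum, mul_assoc]
    exact Finset.sum_congr rfl fun k _ => by rw [map_commute]
  rw [firstOrderOp, Finset.sum_add_distrib, ← e1, ← e2, two_smul]

/-- The Leibniz rule places `a_i ∂_i f` once after `δ_i` and once before `d_i`, which is already the
symmetric ordering of a quantized linear function. -/
lemma opComm_diagonalOp_map (H : IsCalculus M δ d D) (a : ι → R) (f : R) :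
    opComm (diagonalOp M δ d a) (M f) = firstOrderOp M δ d fun i => a i * D i f := by
  simp only [diagonalOp, firstOrderOp, sum_opComm, mul_opComm, opComm_map_map, mul_zero,
    H.d_fun, H.δ_fun, zero_add, map_mul]
  refine Finset.sum_congr rfl fun i _ => ?_
  rw [map_commute M (D i f)]
  noncomm_ring

/-- The coefficients of the operator `iħ(∂H/∂t' - ∂H'/∂t) + [H, H']`. -/
lemma commutator_formula [DecidableEq ι] (H : IsCalculus M δ d D)
    {c₁ c₂ : ℂ} (hc : c₂ = c₁ ^ 2 / 2)
    {a a' α J J' K : ι → R} {U U' V : R}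
    (hJ : IsDivFree M δ d J) (hJ' : IsDivFree M δ d J')
    (hE : opComm (diagonalOp M δ d a) (diagonalOp M δ d a') = 0) :
    -c₁ • (c₂ • diagonalOp M δ d α + (c₁ / 2) • firstOrderOp M δ d K + M V)
      + opComm (c₂ • diagonalOp M δ d a + (c₁ / 2) • firstOrderOp M δ d J + M U)
        (c₂ • diagonalOp M δ d a' + (c₁ / 2) • firstOrderOp M δ d J' + M U')
    = -(c₁ * c₂) • secondOrderOp M δ d (fun i j =>
          (if i = j then α i + fieldDeriv D J' (a i) - fieldDeriv D J (a' i) else 0)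
            - (a j * D j (J' i) + a i * D i (J' j)) + (a' j * D j (J i) + a' i * D i (J j)))
      - c₂ • firstOrderOp M δ d (fun i => K i + fieldDeriv D J' (J i) - fieldDeriv D J (J' i)
          + a' i * D i U - a i * D i U')
      - c₁ • M (V + fieldDeriv D J' U - fieldDeriv D J U') := by
  have eB : (fun i j => (if i = j then α i + fieldDeriv D J' (a i) - fieldDeriv D J (a' i) else 0)
            - (a j * D j (J' i) + a i * D i (J' j)) + (a' j * D j (J i) + a' i * D i (J j)))
      = (fun i j => if i = j then α i else 0)
        + (fun i j => (if i = j then fieldDeriv D J' (a i) else 0)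
            - (a j * D j (J' i) + a i * D i (J' j)))
        - (fun i j => (if i = j then fieldDeriv D J (a' i) else 0)
            - (a' j * D j (J i) + a' i * D i (J j))) := by
    ext i j
    simp only [Pi.add_apply, Pi.sub_apply]
    split_ifs <;> ring
  have eZ : (fun i => K i + fieldDeriv D J' (J i) - fieldDeriv D J (J' i)
          + a' i * D i U - a i * D i U')
      = K - (fun i => fieldDeriv D J (J' i) - fieldDeriv D J' (J i))
        + (fun i => a' i * D i U) - fun i => a i * D i U' := by
    ext i
    simp only [Pi.add_apply, Pi.sub_apply]
    ring
  rw [eB, eZ, secondOrderOp_sub, secondOrderOp_add, secondOrderOp_diagonal,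
    ← opComm_fieldOp_diagonalOp H hJ, ← opComm_fieldOp_diagonalOp H hJ', firstOrderOp_sub,
    firstOrderOp_add, firstOrderOp_sub, ← opComm_diagonalOp_map H, ← opComm_diagonalOp_map H,
    ← opComm_fieldOp_fieldOp H hJ hJ', firstOrderOp_eq_fieldOp hJ,
    firstOrderOp_eq_fieldOp hJ', map_sub, map_add, ← opComm_fieldOp_map H,
    ← opComm_fieldOp_map H]
  simp only [add_opComm, opComm_add, smul_opComm, opComm_smul, hE, opComm_map_map]
  rw [← opComm_skew (diagonalOp M δ d a) (fieldOp M d J'),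
    ← opComm_skew (M U) (diagonalOp M δ d a'), ← opComm_skew (M U) (fieldOp M d J'), hc]
  module

/-- An operator vanishes only if its coefficients do. -/
lemma operator_eq_zero_iff [DecidableEq ι] (H : IsCalculus M δ d D) {x : ι → R}
    (hx : ∀ i j, D i (x j) = if i = j then 1 else 0) {c₀ c₁ c₂ : ℂ} (h₀ : c₀ ≠ 0) (h₁ : c₁ ≠ 0)
    (h₂ : c₂ ≠ 0) {B : ι → ι → R} (hB : ∀ i j, B i j = B j i) {Z : ι → R} {F : R} :
    c₂ • secondOrderOp M δ d B - c₁ • firstOrderOp M δ d Z - c₀ • M F = 0 ↔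
      (∀ i j, B i j = 0) ∧ (∀ i, Z i = 0) ∧ F = 0 := by
  -- Commutators with coordinates extract the symbol. Two of them kill everything of order below two
  -- and see only `B k l + B l k`, whence the symmetry of `B`; once `B` is known to vanish, a single
  -- one isolates `Z`.
  have l1 : ∀ k, opComm (firstOrderOp M δ d Z) (M (x k)) = (2 : ℂ) • M (Z k) := by
    intro k
    simp only [firstOrderOp, sum_opComm, add_opComm, mul_opComm, opComm_map_map, mul_zero,
      zero_mul, H.d_fun, H.δ_fun, zero_add, add_zero, hx]
    rw [Finset.sum_eq_single k]
    · simp [two_smul]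
    · intro j _ hj
      simp [hj]
    · simp
  have l2 : ∀ k l, opComm (opComm (secondOrderOp M δ d B) (M (x k))) (M (x l))
      = (2 : ℂ) • M (B k l) := by
    intro k l
    have e : ∀ i j, opComm (opComm (δ i * M (B i j) * d j) (M (x k))) (M (x l))
        = (if i = l then if j = k then M (B i j) else 0 else 0)
          + (if i = k then if j = l then M (B i j) else 0 else 0) := by
      intro i j
      simp only [mul_opComm, add_opComm, opComm_map_map, mul_zero, zero_mul,
        H.d_fun, H.δ_fun, zero_add, add_zero, hx]
      split_ifs <;> simp
    simp only [secondOrderOp, sum_opComm, e, Finset.sum_add_distrib]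
    simp [hB l k, two_smul]
  constructor
  · intro h
    have hB0 : B = 0 := by
      ext i j
      have := congrArg (fun P => opComm (opComm P (M (x i))) (M (x j))) h
      simp only [sub_opComm, smul_opComm, l1, l2, opComm_map_map, zero_opComm, smul_zero,
        sub_zero] at this
      apply H.injective
      simpa [h₂] using this
    have hS : secondOrderOp M δ d B = 0 := by simp [hB0, secondOrderOp]
    rw [hS, smul_zero, zero_sub] at h
    have hZ0 : Z = 0 := by
      ext i
      have := congrArg (fun P => opComm P (M (x i))) h
      simp only [sub_opComm, neg_opComm, smul_opComm, l1, opComm_map_map, zero_opComm, smul_zero,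
        sub_zero] at this
      apply H.injective
      simpa [h₁] using this
    have hF : firstOrderOp M δ d Z = 0 := by simp [hZ0, firstOrderOp]
    rw [hF, smul_zero, neg_zero, zero_sub, neg_eq_zero, smul_eq_zero_iff_right h₀,
      ← map_zero M] at h
    exact ⟨fun i j => by simp [hB0], fun i => by simp [hZ0], H.injective h⟩
  · rintro ⟨hB, hZ, hF⟩
    simp [secondOrderOp, firstOrderOp, hB, hZ, hF]

end Operators

/-! ### Stäckel systems -/

section Stackel

variable {ι R A : Type*} [Fintype ι] [DecidableEq ι] [CommRing R] [Algebra ℂ R] [Ring A]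
  [Algebra ℂ A]

omit [Fintype ι] in
lemma map_one_matrix (M : R →ₐ[ℂ] A) (i j : ι) :
    M ((1 : Matrix ι ι R) i j) = if i = j then 1 else 0 := by
  rw [Matrix.one_apply]
  split_ifs <;> simp

/-- If `U` is a Stäckel matrix with inverse `S` and the operators `L_k` commute with each other and
with the rows of `U` other than the `k`-th, then the operators `Σ_k S_{rk} L_k` commute. -/
lemma stackel_operators_commute (M : R →ₐ[ℂ] A) {U S : Matrix ι ι R} (hUS : U * S = 1)
    {L : ι → A} (hL : ∀ k l, opComm (L k) (L l) = 0)
    (hLU : ∀ k l r, l ≠ k → opComm (L k) (M (U l r)) = 0) (p q : ι) :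
    opComm (∑ k, M (S p k) * L k) (∑ k, M (S q k) * L k) = 0 := by
  obtain ⟨E, hE⟩ : ∃ E : ι → A, ∀ r, E r = ∑ k, M (S r k) * L k := ⟨_, fun _ => rfl⟩
  have hSU : S * U = 1 := mul_eq_one_comm.mp hUS
  have hLE : ∀ k, L k = ∑ r, M (U k r) * E r := by
    intro k
    simp only [hE, Finset.mul_sum, ← mul_assoc, ← map_mul]
    rw [Finset.sum_comm]
    simp only [← Finset.sum_mul, ← map_sum, ← Matrix.mul_apply, hUS, map_one_matrix]
    simp
  -- For `k = l` the sum is antisymmetric under exchange of `r` and `s`. For `k ≠ l` it is `[L_k,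
  -- L_l]` up to terms containing `[L_k, U_{ls}]` or `[L_l, U_{kr}]`, all of which vanish.
  have key : ∀ k l, ∑ r, ∑ s, M (U k r * U l s) * opComm (E r) (E s) = 0 := by
    intro k l
    by_cases hkl : l = k
    · subst hkl
      have e : ∑ r, ∑ s, M (U l r * U l s) * opComm (E r) (E s)
          = -∑ r, ∑ s, M (U l r * U l s) * opComm (E r) (E s) := by
        conv_lhs => rw [Finset.sum_comm]
        rw [← Finset.sum_neg_distrib]
        refine Finset.sum_congr rfl fun r _ => ?_
        rw [← Finset.sum_neg_distrib]
        refine Finset.sum_congr rfl fun s _ => ?_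
        rw [← opComm_skew, mul_neg, mul_comm (U l s)]
      rw [eq_neg_iff_add_eq_zero, ← two_smul ℂ] at e
      exact (smul_eq_zero_iff_right two_ne_zero).mp e
    · have h2 : ∀ s, ∑ r, M (U k r) * opComm (E r) (M (U l s)) = 0 := by
        intro s
        have := hLU k l s hkl
        rw [hLE k] at this
        simpa only [sum_opComm, mul_opComm, opComm_map_map, zero_mul, add_zero] using this
      have h3 : ∀ r, ∑ s, M (U l s) * opComm (E s) (M (U k r)) = 0 := by
        intro r
        have := hLU l k r (Ne.symm hkl)
        rw [hLE l] at this
        simpa only [sum_opComm, mul_opComm, opComm_map_map, zero_mul, add_zero] using this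
      have e : ∀ r s, M (U k r * U l s) * opComm (E r) (E s)
          = opComm (M (U k r) * E r) (M (U l s) * E s)
            - M (U k r) * opComm (E r) (M (U l s)) * E s
            + M (U l s) * opComm (E s) (M (U k r)) * E r := by
        intro r s
        rw [map_mul]
        have := map_commute M (U l s) (U k r)
        simp only [opComm, mul_sub, sub_mul]
        simp only [← mul_assoc, this]
        abel
      simp only [e, Finset.sum_add_distrib, Finset.sum_sub_distrib]
      rw [Finset.sum_comm (f := fun r s => M (U k r) * opComm (E r) (M (U l s)) * E s)]
      simp only [← Finset.sum_mul, h2, h3, zero_mul, Finset.sum_const_zero, add_zero, sub_zero]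
      simp only [← opComm_sum, ← sum_opComm, ← hLE, hL]
  -- Contracting with `S` in both indices undoes the two factors `U` and isolates a single
  -- commutator.
  have fin : ∑ k, ∑ l, M (S p k * S q l) * ∑ r, ∑ s, M (U k r * U l s) * opComm (E r) (E s)
      = opComm (E p) (E q) := by
    have e1 : ∀ k l, M (S p k * S q l) * ∑ r, ∑ s, M (U k r * U l s) * opComm (E r) (E s)
        = ∑ r, ∑ s, M (S p k * U k r) * (M (S q l * U l s) * opComm (E r) (E s)) := by
      intro k l
      simp only [Finset.mul_sum]
      refine Finset.sum_congr rfl fun r _ => Finset.sum_congr rfl fun s _ => ?_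
      rw [← mul_assoc, ← mul_assoc, ← map_mul, ← map_mul]
      congr 2
      ring
    have e2 : ∀ k, ∑ l, ∑ r, ∑ s, M (S p k * U k r) * (M (S q l * U l s) * opComm (E r) (E s))
        = ∑ r, M (S p k * U k r) * opComm (E r) (E q) := by
      intro k
      rw [Finset.sum_comm]
      refine Finset.sum_congr rfl fun r _ => ?_
      rw [Finset.sum_comm]
      simp only [← Finset.mul_sum, ← Finset.sum_mul, ← map_sum, ← Matrix.mul_apply, hSU,
        map_one_matrix]
      simp
    simp only [e1, e2]
    rw [Finset.sum_comm]
    simp only [← Finset.sum_mul, ← map_sum, ← Matrix.mul_apply, hSU, map_one_matrix]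
    simp
  rw [← hE, ← hE, ← fin]
  simp only [key, mul_zero, Finset.sum_const_zero]

/-- The derivatives of the inverse of a Stäckel matrix. -/
lemma stackel_symmetry {U S : Matrix ι ι R} (hUS : U * S = 1) (D : ι → Derivation ℂ R R)
    (hU : ∀ i k l, k ≠ i → D i (U k l) = 0) (i j r s : ι) :
    S r i * D i (S s j) = S s i * D i (S r j) := by
  have hSU : S * U = 1 := mul_eq_one_comm.mp hUS
  -- From `∂S = -S (∂U) S`: only row `i` of `U` depends on the `i`-th variable, so `∂_i S` has rank
  -- one and its second factor does not involve `s`.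
  have e : ∀ s, D i (S s j) = -(S s i * ∑ l, D i (U i l) * S l j) := by
    intro s
    have h1 : ∀ k, ∑ l, U k l * D i (S l j) = -∑ l, D i (U k l) * S l j := by
      intro k
      have : D i ((U * S) k j) = 0 := by
        rw [hUS, Matrix.one_apply]
        split_ifs <;> simp
      simp only [Matrix.mul_apply, map_sum, Derivation.leibniz, smul_eq_mul,
        Finset.sum_add_distrib] at this
      rw [eq_neg_iff_add_eq_zero, ← this]
      congr 1
      exact Finset.sum_congr rfl fun l _ => mul_comm _ _
    have h2 : ∑ k, S s k * ∑ l, U k l * D i (S l j) = D i (S s j) := by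
      simp only [Finset.mul_sum, ← mul_assoc]
      rw [Finset.sum_comm]
      simp only [← Finset.sum_mul, ← Matrix.mul_apply, hSU, Matrix.one_apply]
      simp
    rw [← h2]
    simp only [h1]
    rw [Finset.sum_eq_single i]
    · ring
    · intro k _ hk
      simp [hU i k _ hk]
    · simp
  rw [e, e]
  ring

/-- For a separable metric the operators `Σ_k δ_k S_{rk} f_k d_k` commute. -/
lemma diagonalOp_commute {M : R →ₐ[ℂ] A} {δ d : ι → A} {D : ι → Derivation ℂ R R}
    (H : IsCalculus M δ d D) {ω : ι → R} (hδ : ∀ k, δ k = d k + M (ω k))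
    {U S : Matrix ι ι R} (hUS : U * S = 1) (hU : ∀ i k l, k ≠ i → D i (U k l) = 0)
    {f g : ι → R} (hf : ∀ k l, k ≠ l → D k (f l) = 0) (hg : ∀ k l, k ≠ l → D k (g l) = 0)
    (hS : ∀ r k, D k (S r k * f k) + ω k * (S r k * f k) = S r k * g k) (p q : ι) :
    opComm (diagonalOp M δ d fun k => S p k * f k) (diagonalOp M δ d fun k => S q k * f k) = 0 := by
  -- By `hS` the factor `S_{rk}` can be pulled to the left of `δ_k`; what remains involves the
  -- `k`-th variable alone.
  have e : ∀ r, diagonalOp M δ d (fun k => S r k * f k)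
      = ∑ k, M (S r k) * ((M (f k) * d k + M (g k)) * d k) := by
    intro r
    refine Finset.sum_congr rfl fun k _ => ?_
    have h1 := H.d_fun k (S r k * f k)
    rw [opComm, sub_eq_iff_eq_add] at h1
    rw [hδ, add_mul, h1, ← map_mul, add_right_comm, ← map_add, hS, map_mul, map_mul]
    noncomm_ring
  rw [e, e]
  have L1 : ∀ k u, D k u = 0 → opComm ((M (f k) * d k + M (g k)) * d k) (M u) = 0 := by
    intro k u hu
    simp only [mul_opComm, add_opComm, H.d_fun, hu, opComm_map_map, map_zero]
    simp
  have L2 : ∀ k l, l ≠ k → opComm ((M (f k) * d k + M (g k)) * d k) (d l) = 0 := by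
    intro k l hlk
    simp only [mul_opComm, add_opComm, H.d_d, ← opComm_skew (M _) (d _), H.d_fun, hf l k hlk,
      hg l k hlk, map_zero]
    simp
  refine stackel_operators_commute M hUS (fun k l => ?_) (fun k l r hlk => L1 k _ (hU k l r hlk)) p q
  by_cases hlk : l = k
  · rw [hlk, opComm, sub_self]
  · rw [opComm_mul, opComm_add, opComm_mul, L1 k _ (hf k l (Ne.symm hlk)),
      L1 k _ (hg k l (Ne.symm hlk)), L2 k l hlk]
    simp

/-- The quadratic functions `Σ_k S_{rk} f_k y_k²` Poisson commute. -/
lemma diagonal_symmetry {D : ι → Derivation ℂ R R}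
    {U S : Matrix ι ι R} (hUS : U * S = 1) (hU : ∀ i k l, k ≠ i → D i (U k l) = 0)
    {f : ι → R} (hf : ∀ k l, k ≠ l → D k (f l) = 0) (i j r s : ι) :
    S r i * f i * D i (S s j * f j) = S s i * f i * D i (S r j * f j) := by
  have h := stackel_symmetry hUS D hU i j r s
  simp only [Derivation.leibniz, smul_eq_mul]
  -- The extra product-rule term contains `∂_i f_j`; it vanishes for `i ≠ j` and is symmetric in `r`
  -- and `s` for `i = j`.
  by_cases hij : i = j
  · subst hij
    linear_combination f i * f i * h
  · rw [hf i j hij]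
    linear_combination f i * f j * h

end Stackel

/-! ### Multiplications and derivations of a commutative ring as a model of the calculus -/

section EndCalculus

variable {ι R : Type*} [CommRing R] [Algebra ℂ R]

/-- Multiplication operators. -/
def mulOp (R : Type*) [CommRing R] [Algebra ℂ R] : R →ₐ[ℂ] Module.End ℂ R := Algebra.lmul ℂ R

@[simp] lemma mulOp_apply (f g : R) : mulOp R f g = f * g := rfl

/-- The derivations, as operators. -/
def derivOp (D : ι → Derivation ℂ R R) (i : ι) : Module.End ℂ R := (D i : R →ₗ[ℂ] R)

@[simp] lemma derivOp_apply (D : ι → Derivation ℂ R R) (i : ι) (f : R) :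
    derivOp D i f = D i f := rfl

/-- The operators `∂_i + ω_i`, that is `ρ⁻¹ ∂_i ρ` where `ω = d log ρ`. -/
def conjOp (D : ι → Derivation ℂ R R) (ω : ι → R) (i : ι) : Module.End ℂ R :=
  derivOp D i + mulOp R (ω i)

@[simp] lemma conjOp_apply (D : ι → Derivation ℂ R R) (ω : ι → R) (i : ι) (f : R) :
    conjOp D ω i f = D i f + ω i * f := rfl

/-- The shifted derivations commute because `ω` is closed; `M` is injective because a multiplication
operator is determined by its value at `1`. -/
lemma isCalculus_end {D : ι → Derivation ℂ R R} (hD : ∀ i j f, D i (D j f) = D j (D i f))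
    {ω : ι → R} (hω : ∀ i j, D i (ω j) = D j (ω i)) :
    IsCalculus (mulOp R) (conjOp D ω) (derivOp D) D where
  injective f g h := by simpa using congrArg (fun P : Module.End ℂ R => P 1) h
  d_fun i f := by
    ext g
    simp [opComm, mul_comm]
  δ_fun i f := by
    ext g
    simp [opComm]
    ring
  d_d i j := by
    ext g
    simp [opComm, hD i j]
  δ_δ i j := by
    ext g
    simp only [opComm, LinearMap.sub_apply, Module.End.mul_apply, conjOp_apply, map_add,
      Derivation.leibniz, smul_eq_mul, hD i j, hω i j, LinearMap.zero_apply]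
    ring

/-- Moving the `δ_i` past the coefficients produces the field plus multiplication by its weighted
divergence. -/
lemma isDivFree_end [Fintype ι] {D : ι → Derivation ℂ R R} {ω X : ι → R}
    (h : ∑ i, (D i (X i) + ω i * X i) = 0) :
    IsDivFree (mulOp R) (conjOp D ω) (derivOp D) X := by
  have e : ∑ i, conjOp D ω i * mulOp R (X i) = fieldOp (mulOp R) (derivOp D) X
      + mulOp R (∑ i, (D i (X i) + ω i * X i)) := by
    ext f
    simp only [fieldOp, LinearMap.sum_apply, LinearMap.add_apply, mulOp_apply,
      Module.End.mul_apply, conjOp_apply, derivOp_apply, Derivation.leibniz, smul_eq_mul,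
      Finset.sum_mul, ← Finset.sum_add_distrib]
    refine Finset.sum_congr rfl fun i _ => ?_
    ring
  rw [IsDivFree, e, h, map_zero, add_zero]

end EndCalculus

/-! ### The ring of smooth functions on an open set -/

section SmoothRing

open TopologicalSpace

variable {n : ℕ} (Q : Opens (Fin n → ℝ))

/-- The smooth complex functions on `Q`, as a subalgebra of all functions. -/
def smoothSubalgebra : Subalgebra ℂ (Q → ℂ) where
  carrier := {f | ∃ F : (Fin n → ℝ) → ℂ, ContDiffOn ℝ (⊤ : ℕ∞) F Q ∧ ∀ x : Q, F x = f x}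
  mul_mem' := by
    rintro f g ⟨F, hF, hFf⟩ ⟨G, hG, hGg⟩
    exact ⟨fun x => F x * G x, hF.mul hG, fun x => by simp [hFf, hGg]⟩
  add_mem' := by
    rintro f g ⟨F, hF, hFf⟩ ⟨G, hG, hGg⟩
    exact ⟨fun x => F x + G x, hF.add hG, fun x => by simp [hFf, hGg]⟩
  algebraMap_mem' c := ⟨fun _ => c, contDiffOn_const, fun _ => rfl⟩

/-- The ring of smooth complex functions on `Q`. -/
def smoothRing : Type := smoothSubalgebra Q

instance : CommRing (smoothRing Q) := inferInstanceAs (CommRing (smoothSubalgebra Q))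

instance : Algebra ℂ (smoothRing Q) := inferInstanceAs (Algebra ℂ (smoothSubalgebra Q))

variable {Q}

/-- The element of the ring given by a function that is smooth on `Q`. -/
def toSmooth (F : (Fin n → ℝ) → ℂ) (hF : ContDiffOn ℝ (⊤ : ℕ∞) F Q) : smoothRing Q :=
  ⟨fun x => F x, F, hF, fun _ => rfl⟩

lemma smooth_ext {f g : smoothRing Q} (h : ∀ x, f.1 x = g.1 x) : f = g :=
  Subtype.ext (funext h)

lemma exists_toSmooth (f : smoothRing Q) : ∃ F hF, f = toSmooth F hF := by
  obtain ⟨f, F, hF, h⟩ := f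
  exact ⟨F, hF, smooth_ext fun x => (h x).symm⟩

lemma toSmooth_congr {F G : (Fin n → ℝ) → ℂ} {hF : ContDiffOn ℝ (⊤ : ℕ∞) F Q}
    {hG : ContDiffOn ℝ (⊤ : ℕ∞) G Q} (h : ∀ x ∈ Q, F x = G x) : toSmooth F hF = toSmooth G hG :=
  smooth_ext fun x => h x x.2

lemma pd_congr {E : Type*} [NormedAddCommGroup E] [NormedSpace ℝ E]
    {F G : (Fin n → ℝ) → E} (h : ∀ x ∈ Q, F x = G x) (i : Fin n) {x : Fin n → ℝ} (hx : x ∈ Q) :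
    pd i F x = pd i G x := by
  have : F =ᶠ[nhds x] G := Filter.eventually_of_mem (Q.2.mem_nhds hx) h
  rw [pd, pd, this.fderiv_eq]

lemma contDiffOn_pd {E : Type*} [NormedAddCommGroup E] [NormedSpace ℝ E]
    {F : (Fin n → ℝ) → E} (hF : ContDiffOn ℝ (⊤ : ℕ∞) F Q) (i : Fin n) :
    ContDiffOn ℝ (⊤ : ℕ∞) (pd i F) Q :=
  (hF.fderiv_of_isOpen Q.2 (by simp)).clm_apply contDiffOn_const

lemma differentiableAt_of_smooth {E : Type*} [NormedAddCommGroup E] [NormedSpace ℝ E]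
    {F : (Fin n → ℝ) → E} (hF : ContDiffOn ℝ (⊤ : ℕ∞) F Q) {x : Fin n → ℝ} (hx : x ∈ Q) :
    DifferentiableAt ℝ F x :=
  (hF.contDiffAt (Q.2.mem_nhds hx)).differentiableAt (by simp)

lemma pd_pd_comm {E : Type*} [NormedAddCommGroup E] [NormedSpace ℝ E]
    {F : (Fin n → ℝ) → E} (hF : ContDiffOn ℝ (⊤ : ℕ∞) F Q) (i j : Fin n) {x : Fin n → ℝ}
    (hx : x ∈ Q) : pd i (pd j F) x = pd j (pd i F) x := by
  have hd : DifferentiableAt ℝ (fderiv ℝ F) x :=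
    differentiableAt_of_smooth (hF.fderiv_of_isOpen Q.2 (by simp)) hx
  have e : ∀ i j : Fin n, pd i (pd j F) x
      = fderiv ℝ (fderiv ℝ F) x (Pi.single i 1) (Pi.single j 1) := by
    intro i j
    have : pd j F = fun y => fderiv ℝ F y (Pi.single j 1) := rfl
    rw [pd, this, fderiv_clm_apply hd (differentiableAt_const _)]
    simp
  rw [e, e]
  exact (hF.contDiffAt (Q.2.mem_nhds hx)).isSymmSndFDerivAt
    (by simpa using WithTop.coe_le_coe.mpr (le_top : (2 : ℕ∞) ≤ ⊤)) _ _

lemma pd_ofReal {f : (Fin n → ℝ) → ℝ} {x : Fin n → ℝ} (hf : DifferentiableAt ℝ f x) (i : Fin n) :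
    pd i (fun y => (f y : ℂ)) x = (pd i f x : ℝ) := by
  have := (Complex.ofRealCLM.hasFDerivAt.comp x hf.hasFDerivAt).fderiv
  rw [pd, show (fun y => (f y : ℂ)) = Complex.ofRealCLM ∘ f from rfl, this]
  rfl

/-- The partial derivative of a smooth function on `Q`. -/
def pdSmooth (i : Fin n) (f : smoothRing Q) : smoothRing Q :=
  -- The choice of the extension is immaterial: derivatives at points of the open set `Q` depend
  -- only on values in `Q`.
  toSmooth (pd i f.2.choose) (contDiffOn_pd f.2.choose_spec.1 i)

lemma pdSmooth_toSmooth (i : Fin n) {F : (Fin n → ℝ) → ℂ} (hF : ContDiffOn ℝ (⊤ : ℕ∞) F Q) :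
    pdSmooth i (toSmooth F hF) = toSmooth (pd i F) (contDiffOn_pd hF i) :=
  toSmooth_congr fun _ hx =>
    pd_congr (fun y hy => (toSmooth F hF).2.choose_spec.2 ⟨y, hy⟩) i hx

lemma toSmooth_add {F G : (Fin n → ℝ) → ℂ} (hF : ContDiffOn ℝ (⊤ : ℕ∞) F Q)
    (hG : ContDiffOn ℝ (⊤ : ℕ∞) G Q) :
    toSmooth F hF + toSmooth G hG = toSmooth (fun x => F x + G x) (hF.add hG) := rfl

lemma toSmooth_mul {F G : (Fin n → ℝ) → ℂ} (hF : ContDiffOn ℝ (⊤ : ℕ∞) F Q)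
    (hG : ContDiffOn ℝ (⊤ : ℕ∞) G Q) :
    toSmooth F hF * toSmooth G hG = toSmooth (fun x => F x * G x) (hF.mul hG) := rfl

lemma toSmooth_smul (c : ℂ) {F : (Fin n → ℝ) → ℂ} (hF : ContDiffOn ℝ (⊤ : ℕ∞) F Q) :
    c • toSmooth F hF = toSmooth (fun x => c * F x) (contDiffOn_const.mul hF) := rfl

variable (Q) in
/-- The partial derivatives, as derivations. -/
def partialD (i : Fin n) : Derivation ℂ (smoothRing Q) (smoothRing Q) :=
  Derivation.mk'
    { toFun := pdSmooth i
      map_add' := by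
        intro f g
        obtain ⟨F, hF, rfl⟩ := exists_toSmooth f
        obtain ⟨G, hG, rfl⟩ := exists_toSmooth g
        simp only [toSmooth_add, pdSmooth_toSmooth]
        refine toSmooth_congr fun x hx => ?_
        simp only [pd]
        rw [fderiv_fun_add (differentiableAt_of_smooth hF hx) (differentiableAt_of_smooth hG hx)]
        rfl
      map_smul' := by
        intro c f
        obtain ⟨F, hF, rfl⟩ := exists_toSmooth f
        simp only [toSmooth_smul, pdSmooth_toSmooth, RingHom.id_apply]
        refine toSmooth_congr fun x hx => ?_
        simp only [pd]
        rw [fderiv_const_mul (differentiableAt_of_smooth hF hx)]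
        rfl }
    (by
      intro f g
      obtain ⟨F, hF, rfl⟩ := exists_toSmooth f
      obtain ⟨G, hG, rfl⟩ := exists_toSmooth g
      simp only [LinearMap.coe_mk, AddHom.coe_mk, smul_eq_mul, toSmooth_add, toSmooth_mul,
        pdSmooth_toSmooth]
      refine toSmooth_congr fun x hx => ?_
      simp only [pd]
      rw [fderiv_fun_mul (differentiableAt_of_smooth hF hx) (differentiableAt_of_smooth hG hx)]
      simp)

lemma partialD_toSmooth (i : Fin n) {F : (Fin n → ℝ) → ℂ} (hF : ContDiffOn ℝ (⊤ : ℕ∞) F Q) :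
    partialD Q i (toSmooth F hF) = toSmooth (pd i F) (contDiffOn_pd hF i) :=
  pdSmooth_toSmooth i hF

lemma partialD_comm (i j : Fin n) (f : smoothRing Q) :
    partialD Q i (partialD Q j f) = partialD Q j (partialD Q i f) := by
  obtain ⟨F, hF, rfl⟩ := exists_toSmooth f
  simp only [partialD_toSmooth]
  exact toSmooth_congr fun x hx => pd_pd_comm hF i j hx

lemma contDiffOn_ofReal {F : (Fin n → ℝ) → ℝ} (hF : ContDiffOn ℝ (⊤ : ℕ∞) F Q) :
    ContDiffOn ℝ (⊤ : ℕ∞) (fun x => (F x : ℂ)) Q :=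
  Complex.ofRealCLM.contDiff.comp_contDiffOn hF

/-- The element of the ring given by a real function that is smooth on `Q`. -/
def realSmooth (F : (Fin n → ℝ) → ℝ) (hF : ContDiffOn ℝ (⊤ : ℕ∞) F Q) : smoothRing Q :=
  toSmooth (fun x => (F x : ℂ)) (contDiffOn_ofReal hF)

lemma partialD_realSmooth (i : Fin n) {F : (Fin n → ℝ) → ℝ} (hF : ContDiffOn ℝ (⊤ : ℕ∞) F Q) :
    partialD Q i (realSmooth F hF) = realSmooth (pd i F) (contDiffOn_pd hF i) := by
  rw [realSmooth, partialD_toSmooth]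
  exact toSmooth_congr fun x hx => pd_ofReal (differentiableAt_of_smooth hF hx) i

/-- Evaluation at a point. -/
def evalAt (x : Q) : smoothRing Q →ₐ[ℂ] ℂ :=
  (Pi.evalAlgHom ℂ (fun _ => ℂ) x).comp (smoothSubalgebra Q).val

@[simp] lemma evalAt_toSmooth (F : (Fin n → ℝ) → ℂ) (hF : ContDiffOn ℝ (⊤ : ℕ∞) F Q) (x : Q) :
    evalAt x (toSmooth F hF) = F x := rfl

@[simp] lemma evalAt_realSmooth (F : (Fin n → ℝ) → ℝ) (hF : ContDiffOn ℝ (⊤ : ℕ∞) F Q) (x : Q) :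
    evalAt x (realSmooth F hF) = (F x : ℂ) := rfl

lemma smooth_ext_eval {f g : smoothRing Q} (h : ∀ x, evalAt x f = evalAt x g) : f = g :=
  smooth_ext h

lemma contDiffOn_coord (i : Fin n) : ContDiffOn ℝ (⊤ : ℕ∞) (fun x : Fin n → ℝ => x i) Q :=
  (contDiff_apply ℝ ℝ i).contDiffOn

lemma pd_coord (i j : Fin n) (x : Fin n → ℝ) :
    pd i (fun x : Fin n → ℝ => x j) x = if i = j then 1 else 0 := by
  rw [pd, show (fun x : Fin n → ℝ => x j) = ContinuousLinearMap.proj (R := ℝ) j from rfl,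
    ContinuousLinearMap.fderiv]
  simp [Pi.single_apply, eq_comm]

lemma partialD_coord (i j : Fin n) :
    partialD Q i (realSmooth (fun x => x j) (contDiffOn_coord j)) = if i = j then 1 else 0 := by
  rw [partialD_realSmooth]
  refine smooth_ext_eval fun x => ?_
  rw [evalAt_realSmooth, pd_coord]
  split_ifs <;> simp

end SmoothRing

/-! ### Viète coordinates -/

section Viete

variable {n : ℕ}

lemma hasDerivAt_update {E : Type*} [NormedAddCommGroup E] [NormedSpace ℝ E]
    {f : (Fin n → ℝ) → E} {x : Fin n → ℝ} (hf : DifferentiableAt ℝ f x) (j : Fin n) :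
    HasDerivAt (fun s => f (Function.update x j s)) (pd j f x) (x j) := by
  have h1 := _root_.hasDerivAt_update x j (x j)
  have h2 : HasFDerivAt f (fderiv ℝ f x) (Function.update x j (x j)) := by
    rw [Function.update_eq_self]
    exact hf.hasFDerivAt
  exact h2.comp_hasDerivAt (x j) h1

lemma pd_eq_of_hasDerivAt {E : Type*} [NormedAddCommGroup E] [NormedSpace ℝ E]
    {f : (Fin n → ℝ) → E} {x : Fin n → ℝ} (hf : DifferentiableAt ℝ f x) {j : Fin n} {f' : E}
    (h : HasDerivAt (fun s => f (Function.update x j s)) f' (x j)) : pd j f x = f' :=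
  (hasDerivAt_update hf j).unique h

lemma contDiff_viete (r : ℕ) : ContDiff ℝ (⊤ : ℕ∞) (viete r : (Fin n → ℝ) → ℝ) := by
  have : (viete r : (Fin n → ℝ) → ℝ)
      = fun x => (-1) ^ r * ∑ t ∈ Finset.univ.powersetCard r, ∏ i ∈ t, x i := by
    ext x
    simp [viete, MvPolynomial.esymm]
  rw [this]
  fun_prop

lemma viete_zero (x : Fin n → ℝ) : viete 0 x = 1 := by
  simp [viete]

lemma viete_of_lt {r : ℕ} (hr : n < r) (x : Fin n → ℝ) : viete r x = 0 := by
  have : Finset.powersetCard r (Finset.univ : Finset (Fin n)) = ∅ :=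
    Finset.powersetCard_eq_empty.mpr (by simpa using hr)
  simp [viete, MvPolynomial.esymm, this]

/-- The generating function of the Viète coordinates. -/
lemma prod_sub_eq_sum_viete (x : Fin n → ℝ) (z : ℝ) :
    ∏ i, (z - x i) = ∑ r ∈ Finset.range (n + 1), viete r x * z ^ (n - r) := by
  have h := congrArg (Polynomial.eval z)
    (Multiset.prod_X_sub_X_eq_sum_esymm (Finset.univ.val.map x))
  have e : ∀ r, MvPolynomial.eval x (MvPolynomial.esymm (Fin n) ℝ r)
      = (Finset.univ.val.map x).esymm r := by
    intro r
    rw [← MvPolynomial.aeval_esymm_eq_multiset_esymm (σ := Fin n) (R := ℝ),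
      MvPolynomial.aeval_eq_eval]
  have e' : (((Finset.univ.val.map x).map fun t => Polynomial.X - Polynomial.C t).prod)
      = ∏ i, (Polynomial.X - Polynomial.C (x i)) := by
    rw [Multiset.map_map]
    rfl
  rw [e', Polynomial.eval_prod, Polynomial.eval_finsetSum] at h
  simp only [Multiset.card_map, Finset.card_val, Finset.card_univ, Fintype.card_fin,
    Polynomial.eval_sub, Polynomial.eval_X, Polynomial.eval_C, Polynomial.eval_mul,
    Polynomial.eval_pow, Polynomial.eval_neg, Polynomial.eval_one] at h
  rw [h]
  exact Finset.sum_congr rfl fun r _ => by rw [viete, e, mul_assoc]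

/-- Differentiate the generating polynomial in `λ_j` at fixed `z`. The term `r = 0` drops out since
`ρ_0` is constant. -/
lemma prod_sub_eq_sum_pd_viete (x : Fin n → ℝ) (j : Fin n) (z : ℝ) :
    -∏ i ∈ Finset.univ.erase j, (z - x i)
      = ∑ r : Fin n, pd j (viete (r + 1)) x * z ^ (n - (r + 1)) := by
  have hv : ∀ r, HasDerivAt (fun s => viete r (Function.update x j s)) (pd j (viete r) x) (x j) :=
    fun r => hasDerivAt_update (((contDiff_viete r).differentiable (by simp)) x) j
  have h1 : HasDerivAt (fun s => (z - s) * ∏ i ∈ Finset.univ.erase j, (z - x i))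
      (-1 * ∏ i ∈ Finset.univ.erase j, (z - x i)) (x j) :=
    ((hasDerivAt_id (x j)).const_sub z).mul_const _
  have h2 : HasDerivAt
      (fun s => ∑ r ∈ Finset.range (n + 1), viete r (Function.update x j s) * z ^ (n - r))
      (∑ r ∈ Finset.range (n + 1), pd j (viete r) x * z ^ (n - r)) (x j) :=
    HasDerivAt.fun_sum fun r _ => (hv r).mul_const _
  have e : (fun s => ∑ r ∈ Finset.range (n + 1), viete r (Function.update x j s) * z ^ (n - r))
      = fun s => (z - s) * ∏ i ∈ Finset.univ.erase j, (z - x i) := by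
    ext s
    rw [← prod_sub_eq_sum_viete, ← Finset.mul_prod_erase _ _ (Finset.mem_univ j),
      Function.update_self]
    congr 1
    refine Finset.prod_congr rfl fun i hi => ?_
    rw [Function.update_of_ne (Finset.ne_of_mem_erase hi)]
  rw [e] at h2
  have h3 := h1.unique h2
  have h0 : pd j (viete 0) x = 0 :=
    (hv 0).unique (by simpa only [viete_zero] using hasDerivAt_const (x j) (1 : ℝ))
  rw [neg_one_mul, Finset.sum_range_succ', h0, zero_mul, add_zero] at h3
  rw [h3, ← Fin.sum_univ_eq_sum_range (fun r => pd j (viete (r + 1)) x * z ^ (n - (r + 1)))]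

/-- `∂ρ_r/∂λ_j` does not depend on `λ_j`. -/
lemma pd_viete_update (x : Fin n → ℝ) (j : Fin n) (s : ℝ) (r : Fin n) :
    pd j (viete (r + 1)) (Function.update x j s) = pd j (viete (r + 1)) x := by
  -- The generating polynomial of these derivatives is a product over `i ≠ j`, so `λ_j` is absent
  -- from it; comparing coefficients in `z` gives the claim.
  have h : ∀ z, ∑ r : Fin n, pd j (viete (r + 1)) (Function.update x j s) * z ^ (n - (r + 1))
      = ∑ r : Fin n, pd j (viete (r + 1)) x * z ^ (n - (r + 1)) := by
    intro z
    rw [← prod_sub_eq_sum_pd_viete, ← prod_sub_eq_sum_pd_viete]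
    congr 1
    refine Finset.prod_congr rfl fun i hi => ?_
    rw [Function.update_of_ne (Finset.ne_of_mem_erase hi)]
  have hp : ∑ r : Fin n, Polynomial.C (pd j (viete (r + 1)) (Function.update x j s))
        * Polynomial.X ^ (n - (r + 1))
      = ∑ r : Fin n, Polynomial.C (pd j (viete (r + 1)) x) * Polynomial.X ^ (n - (r + 1)) := by
    refine Polynomial.funext fun z => ?_
    simpa [Polynomial.eval_finsetSum] using h z
  have hc := congrArg (fun p => Polynomial.coeff p (n - (r + 1))) hp
  have hr : ∀ t : Fin n, (n - (r + 1 : ℕ) = n - (t + 1)) ↔ r = t := by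
    intro t
    rw [Fin.ext_iff]
    omega
  simpa [Polynomial.finsetSum_coeff, Polynomial.coeff_X_pow, hr] using hc

lemma hasDerivAt_viete (x : Fin n → ℝ) (j : Fin n) (r : ℕ) :
    HasDerivAt (fun s => viete r (Function.update x j s)) (pd j (viete r) x) (x j) :=
  hasDerivAt_update (((contDiff_viete r).differentiable (by simp)) x) j

lemma delta_ne_zero {x : Fin n → ℝ} (hx : Function.Injective x) (j : Fin n) : delta x j ≠ 0 :=
  Finset.prod_ne_zero_iff.mpr fun _ hk =>
    sub_ne_zero.mpr fun h => Finset.ne_of_mem_erase hk (hx h.symm)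

lemma contDiff_delta (j : Fin n) : ContDiff ℝ (⊤ : ℕ∞) fun x : Fin n → ℝ => delta x j := by
  unfold delta
  fun_prop

lemma hasDerivAt_delta {x : Fin n → ℝ} (hx : Function.Injective x) (j : Fin n) :
    HasDerivAt (fun s => delta (Function.update x j s) j)
      (delta x j * ∑ k ∈ Finset.univ.erase j, (x j - x k)⁻¹) (x j) := by
  have e : (fun s => delta (Function.update x j s) j)
      = fun s => ∏ k ∈ Finset.univ.erase j, (s - x k) := by
    ext s
    refine Finset.prod_congr rfl fun k hk => ?_
    rw [Function.update_self, Function.update_of_ne (Finset.ne_of_mem_erase hk)]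
  rw [e]
  have h := HasDerivAt.fun_finsetProd (u := Finset.univ.erase j) (f := fun k s => s - x k)
    (f' := fun _ => 1) (x := x j) fun k _ => (hasDerivAt_id (x j)).sub_const (x k)
  refine h.congr_deriv ?_
  rw [Finset.mul_sum]
  refine Finset.sum_congr rfl fun k hk => ?_
  have hne : x j - x k ≠ 0 := sub_ne_zero.mpr fun h => Finset.ne_of_mem_erase hk (hx h.symm)
  rw [delta, ← Finset.mul_prod_erase _ _ hk, smul_eq_mul, mul_one]
  field_simp

/-- The Stäckel matrix `λ_k^{n-r}`. -/
def stackelU (x : Fin n → ℝ) : Matrix (Fin n) (Fin n) ℝ := fun k r => x k ^ (n - (r + 1))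

/-- The inverse of the Stäckel matrix. -/
def stackelS (x : Fin n → ℝ) : Matrix (Fin n) (Fin n) ℝ :=
  fun r k => -(pd k (viete (r + 1)) x) / delta x k

/-- Lagrange interpolation: column `j` of `stackelS` holds the coefficients of the polynomial that
is `1` at `λ_j` and `0` at the other nodes, and `stackelU` evaluates it at the nodes. -/
lemma stackelU_mul_stackelS {x : Fin n → ℝ} (hx : Function.Injective x) :
    stackelU x * stackelS x = 1 := by
  ext k j
  have h := prod_sub_eq_sum_pd_viete x j (x k)
  have e : (stackelU x * stackelS x) k j
      = (∏ i ∈ Finset.univ.erase j, (x k - x i)) / delta x j := by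
    rw [← neg_neg (∏ i ∈ Finset.univ.erase j, (x k - x i)), h, Matrix.mul_apply,
      ← Finset.sum_neg_distrib, Finset.sum_div]
    refine Finset.sum_congr rfl fun r _ => ?_
    rw [stackelU, stackelS]
    ring
  rw [e, Matrix.one_apply]
  split_ifs with hkj
  · subst hkj
    exact div_self (delta_ne_zero hx k)
  · rw [Finset.prod_eq_zero (i := k) (by simp [hkj]) (sub_self _), zero_div]

/-- The product of the Stäckel matrix and its inverse in the other order: it expresses `∂q_l/∂q_k =
δ_{lk}`. -/
lemma sum_pd_viete_mul {x : Fin n → ℝ} (hx : Function.Injective x) {k : ℕ} (hk : k ∈ Finset.Icc 1 n)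
    (l : ℕ) : ∑ i, pd i (viete l) x * (x i ^ (n - k) / delta x i) = if l = k then -1 else 0 := by
  rw [Finset.mem_Icc] at hk
  by_cases hl : 1 ≤ l ∧ l ≤ n
  · have h := congrArg (fun A : Matrix (Fin n) (Fin n) ℝ => A ⟨l - 1, by omega⟩ ⟨k - 1, by omega⟩)
      (mul_eq_one_comm.mp (stackelU_mul_stackelS hx))
    beta_reduce at h
    rw [Matrix.mul_apply, Matrix.one_apply] at h
    simp only [stackelU, stackelS, Nat.sub_add_cancel hk.1, Nat.sub_add_cancel hl.1,
      Fin.mk.injEq] at h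
    have e : (l - 1 = k - 1) ↔ l = k := by omega
    simp only [e] at h
    rw [← neg_inj, ← Finset.sum_neg_distrib]
    convert h using 1
    · exact Finset.sum_congr rfl fun i _ => by ring
    · split_ifs <;> simp
  -- Outside `1 ≤ l ≤ n` the function `ρ_l` is constant, equal to `1` or `0`.
  · have h0 : ∀ i, pd i (viete l) x = 0 := by
      intro i
      refine (hasDerivAt_viete x i l).unique ?_
      have : (fun s => viete l (Function.update x i s)) = fun _ => if l = 0 then 1 else 0 := by
        ext s
        split_ifs with h
        · rw [h, viete_zero]
        · exact viete_of_lt (by omega) _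
      rw [this]
      exact hasDerivAt_const _ _
    simp only [h0, zero_mul, Finset.sum_const_zero]
    rw [if_neg (by omega)]

lemma pd_viete_one (x : Fin n → ℝ) (i : Fin n) : pd i (viete 1) x = -1 := by
  have h : (viete 1 : (Fin n → ℝ) → ℝ) = fun x => -∑ j, x j := by
    ext x
    simp [viete]
  refine (hasDerivAt_viete x i 1).unique ?_
  have e : ∀ s, viete 1 (Function.update x i s) = -(s + ∑ j ∈ Finset.univ.erase i, x j) := by
    intro s
    rw [h]
    simp only
    rw [← Finset.add_sum_erase _ _ (Finset.mem_univ i)]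
    simp only [Function.update_self]
    congr 2
    exact Finset.sum_congr rfl fun j hj => Function.update_of_ne (Finset.ne_of_mem_erase hj) _ _
  simp only [e]
  exact ((hasDerivAt_id (x i)).add_const _).neg

/-- The duality for `l = 1` and `k = n - p ≥ 2`, since all partial derivatives of `ρ_1` are `-1`. -/
lemma sum_pow_div_delta {x : Fin n → ℝ} (hx : Function.Injective x) {p : ℕ} (hp : p + 2 ≤ n) :
    ∑ i, x i ^ p / delta x i = 0 := by
  have h := sum_pd_viete_mul hx (k := n - p) (Finset.mem_Icc.mpr ⟨by omega, by omega⟩) 1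
  rw [if_neg (by omega), show n - (n - p) = p by omega] at h
  simpa [pd_viete_one] using h

lemma viete_self (x : Fin n → ℝ) : viete n x = ∏ i, -x i := by
  have h := prod_sub_eq_sum_viete x 0
  rw [Finset.sum_range_succ, Finset.sum_eq_zero] at h
  · simpa using h.symm
  · intro r hr
    rw [zero_pow (by have := Finset.mem_range.mp hr; omega), mul_zero]

/-- The duality for `l = k = n`, since `∂ρ_n/∂λ_i = ρ_n/λ_i`. -/
lemma sum_inv_div_delta {x : Fin n → ℝ} (hx : Function.Injective x) (hx0 : ∀ i, x i ≠ 0)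
    (hn : 1 ≤ n) : viete n x * ∑ i, (x i)⁻¹ / delta x i = -1 := by
  have h := sum_pd_viete_mul hx (Finset.mem_Icc.mpr ⟨hn, le_refl n⟩) n
  rw [if_pos rfl] at h
  rw [← h, Finset.mul_sum]
  refine Finset.sum_congr rfl fun i _ => ?_
  have e : pd i (viete n) x = viete n x * (x i)⁻¹ := by
    refine (hasDerivAt_viete x i n).unique ?_
    have e1 : ∀ s, viete n (Function.update x i s) = -s * ∏ j ∈ Finset.univ.erase i, -x j := by
      intro s
      rw [viete_self, ← Finset.mul_prod_erase _ _ (Finset.mem_univ i), Function.update_self]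
      congr 1
      refine Finset.prod_congr rfl fun j hj => ?_
      rw [Function.update_of_ne (Finset.ne_of_mem_erase hj)]
    simp only [e1]
    have e2 : viete n x * (x i)⁻¹ = -1 * ∏ j ∈ Finset.univ.erase i, -x j := by
      rw [viete_self, ← Finset.mul_prod_erase _ _ (Finset.mem_univ i)]
      field_simp [hx0 i]
    rw [e2]
    exact (hasDerivAt_id (x i)).neg.mul_const _
  rw [e, Nat.sub_self, pow_zero]
  ring

end Viete

/-! ### The configuration space and its density -/

section Density

variable {n m : ℕ}

lemma isOpen_configSpace (n m : ℕ) : IsOpen (configSpace n m) := by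
  have e : configSpace n m = (⋂ i : Fin n, ⋂ j : Fin n, {x | i ≠ j → x i ≠ x j})
      ∩ ⋂ i : Fin n, {x | m ≠ 0 → x i ≠ 0} := by
    ext x
    simp only [configSpace, Set.mem_ofPred_eq, Set.mem_inter_iff, Set.mem_iInter]
    refine and_congr ?_ ⟨fun h i hm => h hm i, fun h hm i => h i hm⟩
    exact ⟨fun h i j hij => h.ne hij, fun h i j hij => by_contra fun hne => h i j hne hij⟩
  rw [e]
  refine (isOpen_iInter_of_finite fun i => isOpen_iInter_of_finite fun j => ?_).inter
    (isOpen_iInter_of_finite fun i => ?_)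
  · by_cases h : i = j
    · simp [h]
    · simpa [h] using isOpen_ne_fun (continuous_apply i) (continuous_apply j)
  · by_cases h : m = 0
    · simp [h]
    · simpa [h] using isOpen_ne_fun (continuous_apply i) continuous_const

/-- The configuration space as an open set. -/
def configOpens (n m : ℕ) : TopologicalSpace.Opens (Fin n → ℝ) :=
  ⟨configSpace n m, isOpen_configSpace n m⟩

lemma coord_pow_ne_zero {x : Fin n → ℝ} (hx : x ∈ configSpace n m) (i : Fin n) : x i ^ m ≠ 0 := by
  by_cases h : m = 0
  · simp [h]
  · exact pow_ne_zero _ (hx.2 h i)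

/-- The logarithm of the density. -/
def logDensity (m : ℕ) (x : Fin n → ℝ) : ℝ :=
  (∑ i, ∑ k ∈ Finset.univ.erase i, Real.log (x i - x k) - ∑ i, Real.log (x i ^ m)) / 2

lemma density_eq {x : Fin n → ℝ} (hx : x ∈ configSpace n m) :
    density (metricg m) x = Real.exp (logDensity m x) := by
  have hd : ∀ i : Fin n, x i ^ m / delta x i ≠ 0 := fun i =>
    div_ne_zero (coord_pow_ne_zero hx i) (delta_ne_zero hx.1 i)
  have hdet : (metricg m x).det = ∏ i, (x i ^ m / delta x i)⁻¹ := by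
    rw [metricg, Matrix.det_nonsing_inv, metricG, Matrix.det_diagonal, Ring.inverse_eq_inv,
      Finset.prod_inv_distrib]
  have hdet0 : (metricg m x).det ≠ 0 := by
    rw [hdet]
    exact Finset.prod_ne_zero_iff.mpr fun i _ => inv_ne_zero (hd i)
  -- No absolute values are needed: `Real.log` is even, so negative differences and determinants
  -- cause no harm.
  have hlog : Real.log (metricg m x).det = 2 * logDensity m x := by
    rw [hdet, Real.log_prod fun i _ => inv_ne_zero (hd i), logDensity, mul_div_cancel₀ _ two_ne_zero,
      ← Finset.sum_sub_distrib]
    refine Finset.sum_congr rfl fun i _ => ?_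
    rw [Real.log_inv, Real.log_div (coord_pow_ne_zero hx i) (delta_ne_zero hx.1 i), delta,
      Real.log_prod fun k hk => ?_]
    · ring
    · exact sub_ne_zero.mpr fun h => Finset.ne_of_mem_erase hk (hx.1 h.symm)
  rw [density, Real.sqrt_eq_rpow, Real.rpow_def_of_pos (abs_pos.mpr hdet0), Real.log_abs, hlog]
  congr 1
  ring

lemma contDiffOn_logDensity :
    ContDiffOn ℝ (⊤ : ℕ∞) (logDensity m : (Fin n → ℝ) → ℝ) (configOpens n m) := by
  have h1 : ∀ i k : Fin n, k ∈ Finset.univ.erase i → ContDiffOn ℝ (⊤ : ℕ∞)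
      (fun x : Fin n → ℝ => Real.log (x i - x k)) (configOpens n m) := fun i k hk =>
    ContDiffOn.log (by fun_prop) fun x hx =>
      sub_ne_zero.mpr fun h => Finset.ne_of_mem_erase hk (hx.1 h.symm)
  have h2 : ∀ i : Fin n, ContDiffOn ℝ (⊤ : ℕ∞)
      (fun x : Fin n → ℝ => Real.log (x i ^ m)) (configOpens n m) := fun i =>
    ContDiffOn.log (by fun_prop) fun x hx => coord_pow_ne_zero hx i
  exact ((ContDiffOn.sum fun i _ => ContDiffOn.sum fun k hk => h1 i k hk).sub
    (ContDiffOn.sum fun i _ => h2 i)).div_const 2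

lemma hasDerivAt_update_coord (x : Fin n → ℝ) (j i : Fin n) :
    HasDerivAt (fun s => Function.update x j s i) (if i = j then 1 else 0) (x j) := by
  have h := hasDerivAt_pi.mp (_root_.hasDerivAt_update x j (x j)) i
  simpa [Pi.single_apply] using h

lemma pd_logDensity {x : Fin n → ℝ} (hx : x ∈ configSpace n m) (j : Fin n) :
    pd j (logDensity m) x = ∑ k ∈ Finset.univ.erase j, (x j - x k)⁻¹ - m / 2 / x j := by
  refine pd_eq_of_hasDerivAt (differentiableAt_of_smooth contDiffOn_logDensity hx) ?_
  have hne : ∀ i k, k ∈ Finset.univ.erase i → x i - x k ≠ 0 := fun i k hk =>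
    sub_ne_zero.mpr fun h => Finset.ne_of_mem_erase hk (hx.1 h.symm)
  have h1 : ∀ i k, k ∈ Finset.univ.erase i →
      HasDerivAt (fun s => Real.log (Function.update x j s i - Function.update x j s k))
        (((if i = j then 1 else 0) - if k = j then 1 else 0) / (x i - x k)) (x j) := by
    intro i k hk
    have h := ((hasDerivAt_update_coord x j i).sub (hasDerivAt_update_coord x j k)).log
      (by simpa using hne i k hk)
    simpa using h
  have h2 : ∀ i, HasDerivAt (fun s => Real.log (Function.update x j s i ^ m))
      (if i = j then m / x j else 0) (x j) := by
    intro i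
    have h := ((hasDerivAt_update_coord x j i).pow m).log
      (by simpa using coord_pow_ne_zero hx i)
    refine h.congr_deriv ?_
    split_ifs with hij
    · subst hij
      -- For `m = 0` the coordinate may vanish, but the numerator `m` makes both sides `0`.
      rcases Nat.eq_zero_or_pos m with rfl | hm
      · simp
      · have := hx.2 hm.ne' i
        simp only [Function.update_eq_self]
        have e : x i ^ m = x i ^ (m - 1) * x i := by
          rw [← pow_succ, Nat.sub_add_cancel hm]
        simp [e]
        field_simp
    · simp
  refine (((HasDerivAt.fun_sum fun i _ => HasDerivAt.fun_sum fun k hk => h1 i k hk).sub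
    (HasDerivAt.fun_sum fun i _ => h2 i)).div_const 2).congr_deriv ?_
  -- Each pair occurs as `λ_i - λ_k` and as `λ_k - λ_i`; the resulting factor `2` cancels the `1/2`
  -- in `logDensity`.
  have e1 : ∑ i, ∑ k ∈ Finset.univ.erase i,
      (((if i = j then 1 else 0) - if k = j then 1 else 0) / (x i - x k) : ℝ)
      = 2 * ∑ k ∈ Finset.univ.erase j, (x j - x k)⁻¹ := by
    simp only [sub_div, Finset.sum_sub_distrib]
    have a1 : ∑ i, ∑ k ∈ Finset.univ.erase i, ((if i = j then 1 else 0) / (x i - x k) : ℝ)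
        = ∑ k ∈ Finset.univ.erase j, (x j - x k)⁻¹ := by
      rw [Finset.sum_eq_single j (fun i _ hi => by simp [hi]) (by simp)]
      simp
    have a2 : ∑ i, ∑ k ∈ Finset.univ.erase i, ((if k = j then 1 else 0) / (x i - x k) : ℝ)
        = -∑ k ∈ Finset.univ.erase j, (x j - x k)⁻¹ := by
      rw [← Finset.sum_neg_distrib, ← Finset.add_sum_erase _ _ (Finset.mem_univ j),
        Finset.sum_eq_zero, zero_add]
      · refine Finset.sum_congr rfl fun i hi => ?_
        have hij := Finset.ne_of_mem_erase hi
        rw [Finset.sum_eq_single j (fun k _ hk => by simp [hk]) (by simp [hij.symm]), if_pos rfl,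
          one_div, ← neg_sub (x j), inv_neg]
      · intro k hk
        simp [Finset.ne_of_mem_erase hk]
    rw [a1, a2]
    ring
  rw [e1]
  simp
  ring

/-- The coefficients of the separated operators. -/
lemma pd_stackelS_mul {x : Fin n → ℝ} (hx : x ∈ configSpace n m) (r k : Fin n) :
    HasDerivAt (fun s => stackelS (Function.update x k s) r k * Function.update x k s k ^ m)
      (stackelS x r k * (m / 2 * x k ^ (m - 1))
        - pd k (logDensity m) x * (stackelS x r k * x k ^ m)) (x k) := by
  -- Only `Δ_k` and `λ_k^m` contribute. The logarithmic derivative of `Δ_k` cancels against that of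
  -- the density, and `m λ_k^{m-1}` is halved by the density's factor in `λ_k`.
  have h1 : HasDerivAt (fun s => -(pd k (viete (r + 1)) (Function.update x k s))) 0 (x k) := by
    simp only [pd_viete_update]
    exact hasDerivAt_const _ _
  have hd := delta_ne_zero hx.1 k
  have h : HasDerivAt (fun s => stackelS (Function.update x k s) r k * Function.update x k s k ^ m)
      _ (x k) := (h1.div (hasDerivAt_delta hx.1 k) (by simpa using hd)).mul
        ((hasDerivAt_update_coord x k k).pow m)
  refine h.congr_deriv ?_
  rw [pd_logDensity hx]
  simp only [stackelS, Pi.div_apply, Function.update_eq_self, if_true]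
  have hm : (m : ℝ) / 2 / x k * x k ^ m = m / 2 * x k ^ (m - 1) := by
    rcases Nat.eq_zero_or_pos m with rfl | hm
    · simp
    · have := hx.2 hm.ne' k
      have e : x k ^ m = x k ^ (m - 1) * x k := by
        rw [← pow_succ, Nat.sub_add_cancel hm]
      rw [e]
      field_simp
  have hs : ∀ p t : ℝ, (0 * delta x k - -p * (delta x k * t)) / delta x k ^ 2 = p * t / delta x k := by
    intro p t
    field_simp
    ring
  rw [hs]
  linear_combination (pd k (viete (r + 1)) x / delta x k) * hm

/-- The numerical factors of the components of `J_r`. -/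
def coeffJ (n m r k : ℕ) : ℝ :=
  if 2 ≤ r ∧ r + m ≤ n + 1 ∧ n + 2 ≤ m + r + k ∧ k + m ≤ n then (n : ℝ) + 1 - m - k
  else if 2 ≤ r ∧ n + 2 ≤ r + m ∧ r ≤ n ∧ n + 2 ≤ k + m ∧ k + m + r ≤ 2 * n + 2 then
    -((n : ℝ) + 1 - m - k)
  else 0

lemma vieteJ_eq (m r k : ℕ) (x : Fin n → ℝ) :
    vieteJ m r k x = coeffJ n m r k * viete (m + r + k - (n + 2)) x := by
  unfold vieteJ coeffJ
  split_ifs <;> simp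

lemma contDiffOn_fieldJ (m r : ℕ) (i : Fin n) :
    ContDiffOn ℝ (⊤ : ℕ∞) (fun x : Fin n → ℝ => fieldJ m r x i) (configOpens n m) := by
  unfold fieldJ
  simp only [vieteJ_eq]
  refine ContDiffOn.sum fun k _ => ?_
  exact (contDiffOn_const.mul (contDiff_viete _).contDiffOn).mul
    (ContDiffOn.neg (ContDiffOn.div (by fun_prop) (contDiff_delta i).contDiffOn
      fun x hx => delta_ne_zero hx.1 i))

/-- The part of the divergence in which the components of `J_r` are differentiated. The component
along `∂/∂q_k` involves `q_{k+m+r-n-2}`, so it depends on `q_k` only if `r = n + 2 - m`; then the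
factors are `1, …, m - 1`. -/
lemma sum_coeffJ {m r : ℕ} :
    ∑ k ∈ Finset.Icc 1 n, (if m + r + k - (n + 2) = k then coeffJ n m r k else 0)
      = if 2 ≤ r ∧ m + r = n + 2 then (m : ℝ) / 2 * (m - 1) else 0 := by
  by_cases h : 2 ≤ r ∧ m + r = n + 2
  · rw [if_pos h]
    obtain ⟨h2, hmr⟩ := h
    have e : ∀ k ∈ Finset.Icc 1 n, (if m + r + k - (n + 2) = k then coeffJ n m r k else 0)
        = if k ∈ Finset.Icc r n then (k : ℝ) + 1 - r else 0 := by
      intro k hk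
      rw [Finset.mem_Icc] at hk
      have hc : (m : ℝ) + r = n + 2 := by exact_mod_cast hmr
      rw [if_pos (by omega), coeffJ, if_neg (by omega)]
      simp only [Finset.mem_Icc]
      by_cases hrk : r ≤ k ∧ k ≤ n
      · rw [if_pos (by omega), if_pos hrk]
        linear_combination hc
      · rw [if_neg (by omega), if_neg hrk]
    rw [Finset.sum_congr rfl e, ← Finset.sum_filter]
    have hf : (Finset.Icc 1 n).filter (fun k => k ∈ Finset.Icc r n) = Finset.Ico r (n + 1) := by
      ext k
      simp only [Finset.mem_filter, Finset.mem_Icc, Finset.mem_Ico]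
      omega
    rw [hf, Finset.sum_Ico_eq_sum_range]
    rcases m with _ | p
    · rw [show n + 1 - r = 0 by omega]
      simp
    · rw [show n + 1 - r = p by omega]
      have hs : ∀ p : ℕ, ∑ i ∈ Finset.range p, (((r + i : ℕ) : ℝ) + 1 - r) = p * (p + 1) / 2 := by
        intro p
        induction p with
        | zero => simp
        | succ q ih =>
          rw [Finset.sum_range_succ, ih]
          push_cast
          ring
      rw [hs]
      push_cast
      ring
  · rw [if_neg h]
    refine Finset.sum_eq_zero fun k hk => ?_
    rw [Finset.mem_Icc] at hk
    split_ifs with h1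
    · unfold coeffJ
      rw [if_neg (by omega), if_neg (by omega)]
    · rfl

/-- Among the components along `∂/∂q_n`, the only direction whose own divergence can be nonzero,
just the one with `r = n + 2 - m` survives, the same `r` as in `sum_coeffJ`. -/
lemma coeffJ_last {m r : ℕ} (hn : 1 ≤ n) (hm : m ≠ 0) (x : Fin n → ℝ) :
    coeffJ n m r n * viete (m + r + n - (n + 2)) x
      = if 2 ≤ r ∧ m + r = n + 2 then (m - 1) * viete n x else 0 := by
  rw [coeffJ, if_neg (by omega)]
  by_cases h : 2 ≤ r ∧ m + r = n + 2
  · rw [if_pos h, show m + r + n - (n + 2) = n by omega]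
    by_cases hm1 : m = 1
    · subst hm1
      -- Here `r = n + 1` is out of range, so the coefficient is `0`, in agreement with `m - 1 = 0`.
      rw [if_neg (by omega)]
      simp
    · rw [if_pos (by omega)]
      ring
  · rw [if_neg h, if_neg (by omega), zero_mul]

lemma hasDerivAt_fieldJ {x : Fin n → ℝ} (hx : Function.Injective x) (r : ℕ) (i : Fin n) :
    HasDerivAt (fun s => fieldJ m r (Function.update x i s) i)
      (∑ k ∈ Finset.Icc 1 n,
        (-coeffJ n m r k * (pd i (viete (m + r + k - (n + 2))) x * (x i ^ (n - k) / delta x i))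
          - coeffJ n m r k * viete (m + r + k - (n + 2)) x
            * (((n - k : ℕ) : ℝ) * x i ^ (n - k - 1) / delta x i
              - x i ^ (n - k) / delta x i * ∑ k ∈ Finset.univ.erase i, (x i - x k)⁻¹))) (x i) := by
  unfold fieldJ
  simp only [vieteJ_eq]
  refine HasDerivAt.fun_sum fun k _ => ?_
  have hd := delta_ne_zero hx i
  have h : HasDerivAt (fun s => coeffJ n m r k * viete (m + r + k - (n + 2)) (Function.update x i s)
        * -(Function.update x i s i ^ (n - k) / delta (Function.update x i s) i)) _ (x i) :=
    ((hasDerivAt_viete x i _).const_mul _).mul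
      ((((hasDerivAt_update_coord x i i).pow (n - k)).div (hasDerivAt_delta hx i)
        (by simpa using hd)).neg)
  refine h.congr_deriv ?_
  simp only [Pi.pow_apply, Function.update_eq_self, if_true]
  field_simp
  ring

/-- The vector fields `J_r` are divergence free. -/
lemma divergence_fieldJ {x : Fin n → ℝ} (hx : x ∈ configSpace n m) (r : ℕ) :
    ∑ i, (pd i (fun y => fieldJ m r y i) x + pd i (logDensity m) x * fieldJ m r x i) = 0 := by
  have hpd : ∀ i, pd i (fun y => fieldJ m r y i) x = _ := fun i =>
    pd_eq_of_hasDerivAt (differentiableAt_of_smooth (contDiffOn_fieldJ m r i) hx)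
      (hasDerivAt_fieldJ (m := m) hx.1 r i)
  -- The sums of `(λ_i - λ_k)⁻¹` coming from `1/Δ_i` and from the density cancel, leaving single
  -- powers of `λ_i` over `Δ_i`.
  have e : ∀ i, pd i (fun y => fieldJ m r y i) x + pd i (logDensity m) x * fieldJ m r x i
      = ∑ k ∈ Finset.Icc 1 n,
        (-coeffJ n m r k * (pd i (viete (m + r + k - (n + 2))) x * (x i ^ (n - k) / delta x i))
          - coeffJ n m r k * viete (m + r + k - (n + 2)) x
            * ((((n - k : ℕ) : ℝ) * x i ^ (n - k - 1) - m / 2 / x i * x i ^ (n - k))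
                / delta x i)) := by
    intro i
    rw [hpd, pd_logDensity hx, fieldJ, Finset.mul_sum, ← Finset.sum_add_distrib]
    refine Finset.sum_congr rfl fun k _ => ?_
    rw [vieteJ_eq]
    ring
  simp only [e]
  rw [Finset.sum_comm]
  simp only [Finset.sum_sub_distrib, ← Finset.mul_sum]
  have e1 : ∀ k ∈ Finset.Icc 1 n, -coeffJ n m r k
        * ∑ i, pd i (viete (m + r + k - (n + 2))) x * (x i ^ (n - k) / delta x i)
      = if m + r + k - (n + 2) = k then coeffJ n m r k else 0 := by
    intro k hk
    rw [sum_pd_viete_mul hx.1 hk]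
    split_ifs <;> simp
  rw [Finset.sum_congr rfl e1, sum_coeffJ]
  rcases Nat.eq_zero_or_pos n with rfl | hn
  · rw [Finset.Icc_eq_empty (by omega), Finset.sum_empty, sub_zero]
    split_ifs with h
    · have : m = 0 := by omega
      simp [this]
    · rfl
  -- For `k < n` the exponent `n - k - 1` is at most `n - 2`, where the power sums over `Δ_i`
  -- vanish. For `k = n` the exponent is `-1`, and the term left over cancels the `m(m-1)/2` from
  -- `sum_coeffJ`.
  have e2 : ∀ k ∈ Finset.Icc 1 n, k ≠ n →
      coeffJ n m r k * viete (m + r + k - (n + 2)) x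
        * ∑ i, (((n - k : ℕ) : ℝ) * x i ^ (n - k - 1) - m / 2 / x i * x i ^ (n - k)) / delta x i
      = 0 := by
    intro k hk hkn
    rw [Finset.mem_Icc] at hk
    have h : ∀ i, (((n - k : ℕ) : ℝ) * x i ^ (n - k - 1) - m / 2 / x i * x i ^ (n - k)) / delta x i
        = (((n - k : ℕ) : ℝ) - m / 2) * (x i ^ (n - k - 1) / delta x i) := by
      intro i
      have hm : (m : ℝ) / 2 / x i * x i ^ (n - k) = m / 2 * x i ^ (n - k - 1) := by
        rcases Nat.eq_zero_or_pos m with rfl | hm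
        · simp
        · have := hx.2 hm.ne' i
          rw [show n - k = n - k - 1 + 1 by omega, pow_succ, Nat.add_sub_cancel]
          field_simp
      rw [hm]
      ring
    simp only [h, ← Finset.mul_sum]
    rw [sum_pow_div_delta hx.1 (by omega)]
    simp
  rw [Finset.sum_eq_single n e2 (fun h => absurd (Finset.mem_Icc.mpr ⟨hn, le_refl n⟩) h)]
  rcases Nat.eq_zero_or_pos m with rfl | hm
  · simp
  · rw [coeffJ_last hn hm.ne']
    have h := sum_inv_div_delta hx.1 (hx.2 hm.ne') hn
    have e3 : ∑ i, (((n - n : ℕ) : ℝ) * x i ^ (n - n - 1) - m / 2 / x i * x i ^ (n - n)) / delta x i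
        = -(m / 2) * ∑ i, (x i)⁻¹ / delta x i := by
      rw [Finset.mul_sum]
      refine Finset.sum_congr rfl fun i _ => ?_
      rw [Nat.sub_self, Nat.cast_zero, pow_zero]
      ring
    rw [e3]
    split_ifs
    · linear_combination (-(m : ℝ) / 2 * (m - 1) * -1) * h
    · simp

end Density

/-! ### The matrix of the `ζ`-combinations -/

section Combine

variable {n : ℕ}

/-- The matrix with `combine m ζ t h r = Σ_j Z_{rj}(t) h_j`. -/
def zetaMatrix (m : ℕ) (ζ : ℕ → ℕ → (Fin n → ℝ) → ℝ) (r j : ℕ) : (Fin n → ℝ) → ℝ :=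
  if r = 1 ∨ r + m ≤ n + 1 then
    if r ≤ kappa₁ n m then (if j = r then 1 else 0)
    else if j ≤ r then ζ r j else 0
  else
    if r ≤ n - kappa₂ m then (if r ≤ j then ζ r j else 0)
    else if j = r then 1 else 0

lemma sum_fin_eq_sum_Icc {M : Type*} [AddCommMonoid M] (f : ℕ → M) :
    ∑ j : Fin n, f (j + 1) = ∑ j ∈ Finset.Icc 1 n, f j := by
  rw [Fin.sum_univ_eq_sum_range (fun j => f (j + 1)), Finset.range_eq_Ico,
    Finset.sum_Ico_add' f 0 n 1]
  rfl

lemma combine_eq (m : ℕ) (ζ : ℕ → ℕ → (Fin n → ℝ) → ℝ) (t : Fin n → ℝ)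
    {M : Type*} [AddCommGroup M] [Module ℝ M] (h : ℕ → M) (r : Fin n) :
    combine m ζ t h (r + 1) = ∑ j : Fin n, zetaMatrix m ζ (r + 1) (j + 1) t • h (j + 1) := by
  rw [sum_fin_eq_sum_Icc fun j => zetaMatrix m ζ (r + 1) j t • h j]
  have hone : ∑ j ∈ Finset.Icc 1 n,
      (if j = (r + 1 : ℕ) then (1 : (Fin n → ℝ) → ℝ) else 0) t • h j = h (r + 1) := by
    rw [Finset.sum_eq_single (r + 1 : ℕ)]
    · simp
    · intro j _ hj
      simp [hj]
    · intro hr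
      exact absurd (Finset.mem_Icc.mpr ⟨by omega, r.2⟩) hr
  unfold combine zetaMatrix
  split_ifs with h1 h2 h3
  · exact hone.symm
  · have hsub : Finset.Icc 1 (r + 1 : ℕ) ⊆ Finset.Icc 1 n := Finset.Icc_subset_Icc_right r.2
    rw [← Finset.sum_subset hsub]
    · exact Finset.sum_congr rfl fun j hj => by rw [if_pos (Finset.mem_Icc.mp hj).2]
    · intro j hj hj'
      rw [Finset.mem_Icc] at hj hj'
      rw [if_neg (by omega)]
      simp
  · have hsub : Finset.Ico (r + 1 : ℕ) (n + 1) ⊆ Finset.Icc 1 n := by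
      intro j hj
      rw [Finset.mem_Ico] at hj
      rw [Finset.mem_Icc]
      omega
    rw [← Finset.sum_subset hsub]
    · rw [Finset.sum_Ico_eq_sum_range, show n + 1 - (r + 1 : ℕ) = n - (r + 1) + 1 by omega]
      exact Finset.sum_congr rfl fun j _ => by rw [if_pos (by omega)]
    · intro j hj hj'
      rw [Finset.mem_Icc] at hj
      rw [Finset.mem_Ico] at hj'
      rw [if_neg (by omega)]
      simp
  · exact hone.symm

lemma differentiableAt_zetaMatrix {m : ℕ} (hm : m ≤ n + 1) {T : Set (Fin n → ℝ)} (hT : IsOpen T)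
    {ζ : ℕ → ℕ → (Fin n → ℝ) → ℝ} (hζ : ZetaAdmissible m T ζ) (r j : Fin n) {t : Fin n → ℝ}
    (ht : t ∈ T) : DifferentiableAt ℝ (zetaMatrix m ζ (r + 1) (j + 1)) t := by
  have hd : ∀ {f : (Fin n → ℝ) → ℝ}, ContDiffOn ℝ (⊤ : ℕ∞) f T → DifferentiableAt ℝ f t :=
    fun hf => (hf.contDiffAt (hT.mem_nhds ht)).differentiableAt (by simp)
  have h0 : DifferentiableAt ℝ (0 : (Fin n → ℝ) → ℝ) t := differentiableAt_const 0
  have h1 : DifferentiableAt ℝ (1 : (Fin n → ℝ) → ℝ) t := differentiableAt_const 1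
  have hr := r.2
  have hj := j.2
  unfold zetaMatrix
  split_ifs with h2 h3 h4 h5 h6 h7 h8
  · exact h1
  · exact h0
  -- The alternative label `1` cannot reach this branch: `m ≤ n + 1` gives `κ₁ ≥ 1`.
  · have : (r : ℕ) + 1 + m ≤ n + 1 := by
      rcases h2 with h2 | h2
      · unfold kappa₁ at h3
        omega
      · exact h2
    exact hd (hζ.smooth₁ _ _ (by omega) this hr (by omega) h5)
  · exact h0
  · exact hd (hζ.smooth₂ _ _ (by omega) (by omega) h6 h7 hj)
  · exact h0
  · exact h1
  · exact h0

end Combine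

/-! ### The classical Poisson bracket -/

section Classical

variable {ι : Type*} [Fintype ι] [DecidableEq ι]

/-- A quadratic polynomial vanishes only if its coefficients do. -/
lemma quadratic_eq_zero_iff {B : ι → ι → ℂ} (hB : ∀ i j, B i j = B j i) {Z : ι → ℂ} {F : ℂ} :
    (∀ y : ι → ℝ, (1 / 2) * ∑ i, ∑ j, B i j * y i * y j + ∑ i, Z i * y i + F = 0) ↔
      (∀ i j, B i j = 0) ∧ (∀ i, Z i = 0) ∧ F = 0 := by
  constructor
  · intro h
    have hF : F = 0 := by simpa using h 0
    -- Restriction to a coordinate axis; the values at `s = ±1` then separate the even part `B i i`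
    -- from the odd part `Z i`.
    have h1 : ∀ i, ∀ s : ℝ, (1 / 2) * (B i i * s * s) + Z i * s = 0 := by
      intro i s
      have := h (Pi.single i s)
      rw [hF, add_zero, Finset.sum_eq_single i, Finset.sum_eq_single i, Finset.sum_eq_single i]
        at this
      · simpa using this
      all_goals simp +contextual [Pi.single_apply]
    have hZ : ∀ i, Z i = 0 := by
      intro i
      have e1 := h1 i 1
      have e2 := h1 i (-1)
      push_cast at e1 e2
      linear_combination (e1 - e2) / 2
    have hBi : ∀ i, B i i = 0 := by
      intro i
      have e1 := h1 i 1
      have e2 := h1 i (-1)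
      push_cast at e1 e2
      linear_combination e1 + e2
    refine ⟨fun i j => ?_, hZ, hF⟩
    by_cases hij : i = j
    · rw [hij, hBi]
    -- With the diagonal entries and lower terms gone, this point isolates `B i j + B j i`.
    · have := h (Pi.single i 1 + Pi.single j 1)
      have hy : ∀ k, (((Pi.single i 1 + Pi.single j 1 : ι → ℝ) k : ℝ) : ℂ)
          = (if k = i then 1 else 0) + if k = j then 1 else 0 := by
        intro k
        simp only [Pi.add_apply, Pi.single_apply]
        split_ifs <;> simp
      simp only [hZ, hF, hy, add_zero, mul_add,
        Finset.sum_add_distrib, mul_ite, mul_one, mul_zero, Finset.sum_ite_eq',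
        Finset.mem_univ, if_true, hBi, hB j i, zero_add] at this
      linear_combination this
  · rintro ⟨hB, hZ, hF⟩ y
    simp [hB, hZ, hF]

/-- Hypothesis `h3` cancels the cubic terms one by one. The rest is sorted by degree, with the
quadratic coefficients symmetrized to match the second-order coefficients on the quantum side. -/
lemma poisson_expansion {a a' α J J' K dU dU' : ι → ℂ} {da da' dJ dJ' : ι → ι → ℂ} {V : ℂ}
    (h3 : ∀ i k, a' i * da i k = a i * da' i k) (y : ι → ℂ) :
    ((1 / 2) * ∑ k, α k * y k ^ 2 + ∑ k, K k * y k + V)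
      + ∑ i, (((1 / 2) * ∑ k, da i k * y k ^ 2 + ∑ k, dJ i k * y k + dU i) * (a' i * y i + J' i)
        - (a i * y i + J i) * ((1 / 2) * ∑ k, da' i k * y k ^ 2 + ∑ k, dJ' i k * y k + dU' i))
    = (1 / 2) * ∑ i, ∑ j, ((if i = j then α i + (∑ k, J' k * da k i) - ∑ k, J k * da' k i else 0)
            - (a j * dJ' j i + a i * dJ' i j) + (a' j * dJ j i + a' i * dJ i j)) * y i * y j
      + ∑ i, (K i + (∑ k, J' k * dJ k i) - (∑ k, J k * dJ' k i) + a' i * dU i - a i * dU' i) * y i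
      + (V + (∑ k, J' k * dU k) - ∑ k, J k * dU' k) := by
  have e3 : ∀ i, (((1 / 2) * ∑ k, da i k * y k ^ 2 + ∑ k, dJ i k * y k + dU i)
        * (a' i * y i + J' i)
        - (a i * y i + J i) * ((1 / 2) * ∑ k, da' i k * y k ^ 2 + ∑ k, dJ' i k * y k + dU' i))
      = (1 / 2) * ∑ k, J' i * da i k * y k ^ 2 - (1 / 2) * ∑ k, J i * da' i k * y k ^ 2
        + ∑ k, a' i * dJ i k * y i * y k - ∑ k, a i * dJ' i k * y i * y k
        + ∑ k, J' i * dJ i k * y k - ∑ k, J i * dJ' i k * y k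
        + (a' i * dU i * y i - a i * dU' i * y i) + (J' i * dU i - J i * dU' i) := by
    intro i
    have : a' i * ∑ k, da i k * y k ^ 2 = a i * ∑ k, da' i k * y k ^ 2 := by
      simp only [Finset.mul_sum, ← mul_assoc, h3]
    have p : ∀ (s : ℂ) (f g : ι → ℂ), ∑ k, s * f k * g k = s * ∑ k, f k * g k := by
      intro s f g
      simp only [Finset.mul_sum, mul_assoc]
    have p' : ∀ (s : ℂ) (f g : ι → ℂ), ∑ k, s * f k * y i * g k = s * y i * ∑ k, f k * g k := by
      intro s f g
      simp only [Finset.mul_sum]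
      exact Finset.sum_congr rfl fun k _ => by ring
    rw [p, p, p, p, p', p']
    linear_combination (1 / 2 * y i) * this
  simp only [e3]
  have q : ∀ (f : ι → ι → ℂ) (g : ι → ℂ),
      ∑ i, ∑ k, f i k * g k = ∑ k, (∑ i, f i k) * g k := by
    intro f g
    rw [Finset.sum_comm]
    simp only [Finset.sum_mul]
  have d : ∀ f : ι → ℂ, ∑ i, ∑ j, (if i = j then f i else 0) * y i * y j
      = ∑ i, f i * y i ^ 2 := by
    intro f
    refine Finset.sum_congr rfl fun i _ => ?_
    rw [Finset.sum_eq_single i (fun j _ hj => by simp [hj.symm]) (by simp), if_pos rfl]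
    ring
  have c : ∀ f : ι → ι → ℂ, ∑ i, ∑ j, f j i * y i * y j = ∑ i, ∑ j, f i j * y i * y j := by
    intro f
    rw [Finset.sum_comm]
    exact Finset.sum_congr rfl fun i _ => Finset.sum_congr rfl fun j _ => by ring
  simp only [Finset.sum_add_distrib, Finset.sum_sub_distrib, ← Finset.mul_sum, add_mul, sub_mul, d,
    c fun i j => a i * dJ' i j, c fun i j => a' i * dJ i j,
    q (fun i k => J' i * da i k), q (fun i k => J i * da' i k), q (fun i k => J' i * dJ i k),
    q (fun i k => J i * dJ' i k)]
  ring

end Classical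

/-! ### The Hamiltonians in terms of the ring of smooth functions -/

section Hamiltonians

variable {n : ℕ} (m : ℕ)

/-- The coordinate functions. -/
def coordEl (i : Fin n) : smoothRing (configOpens n m) :=
  realSmooth (fun x => x i) (contDiffOn_coord i)

/-- The logarithmic derivatives of the density. -/
def logDensityEl (i : Fin n) : smoothRing (configOpens n m) :=
  realSmooth (pd i (logDensity m)) (contDiffOn_pd contDiffOn_logDensity i)

lemma contDiffOn_stackelS (r k : Fin n) :
    ContDiffOn ℝ (⊤ : ℕ∞) (fun x : Fin n → ℝ => stackelS x r k) (configOpens n m) :=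
  ((contDiffOn_pd (contDiff_viete _).contDiffOn k).neg).div (contDiff_delta k).contDiffOn
    fun _ hx => delta_ne_zero hx.1 k

/-- The Stäckel matrix. -/
def stackelUEl (k r : Fin n) : smoothRing (configOpens n m) := coordEl m k ^ (n - (r + 1 : ℕ))

/-- The inverse of the Stäckel matrix. -/
def stackelSEl (r k : Fin n) : smoothRing (configOpens n m) :=
  realSmooth (fun x => stackelS x r k) (contDiffOn_stackelS m r k)

/-- The diagonal entries of the tensors `A_j`. -/
def tensorEl (j k : Fin n) : smoothRing (configOpens n m) := stackelSEl m j k * coordEl m k ^ m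

/-- The components of the vector fields `J_j`. -/
def fieldEl (j k : Fin n) : smoothRing (configOpens n m) :=
  realSmooth (fun x => fieldJ m (j + 1) x k) (contDiffOn_fieldJ m _ k)

variable {m} in
lemma contDiffOn_potV {α : ℤ} (hα : α ∈ Finset.Icc (-(m : ℤ)) (2 * (n : ℤ) - m + 2)) (r : ℕ) :
    ContDiffOn ℝ (⊤ : ℕ∞) (potV r α : (Fin n → ℝ) → ℝ) (configOpens n m) := by
  have hα' := (Finset.mem_Icc.mp hα).1
  refine ContDiffOn.sum fun j _ => (contDiffOn_pd (contDiff_viete _).contDiffOn j).mul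
    (ContDiffOn.div ?_ (contDiff_delta j).contDiffOn fun _ hx => delta_ne_zero hx.1 j)
  obtain ⟨p, rfl | rfl⟩ := α.eq_nat_or_neg
  · simp only [zpow_natCast]
    exact (contDiffOn_coord j).pow p
  · simp only [zpow_neg, zpow_natCast]
    refine ((contDiffOn_coord j).pow p).inv fun x hx => ?_
    rcases Nat.eq_zero_or_pos p with rfl | hp
    · simp
    -- A genuinely negative exponent satisfies `-p ≥ -m`, so `m ≥ 1` and the coordinates do not
    -- vanish on `Q`.
    · exact pow_ne_zero _ (hx.2 (by omega) j)

/-- The labels of the basic potentials. -/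
abbrev PotentialIndex (n m : ℕ) : Type :=
  Fin n × Finset.Icc (-(m : ℤ)) (2 * (n : ℤ) - m + 2)

/-- The basic potentials. -/
def potentialEl (p : PotentialIndex n m) : smoothRing (configOpens n m) :=
  realSmooth (potV (p.1 + 1) p.2) (contDiffOn_potV p.2.2 _)

lemma partialD_coordEl (i j : Fin n) :
    partialD (configOpens n m) i (coordEl m j) = if i = j then 1 else 0 :=
  partialD_coord i j

lemma partialD_coordEl_pow {i j : Fin n} (h : i ≠ j) (p : ℕ) :
    partialD (configOpens n m) i (coordEl m j ^ p) = 0 := by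
  rw [Derivation.leibniz_pow, partialD_coordEl, if_neg h]
  simp

lemma stackelUEl_mul_stackelSEl :
    (Matrix.of (stackelUEl m) * Matrix.of (stackelSEl m)
      : Matrix (Fin n) (Fin n) (smoothRing (configOpens n m))) = 1 := by
  ext1 k j
  refine smooth_ext_eval fun x => ?_
  have h := congrArg (fun A : Matrix (Fin n) (Fin n) ℝ => ((A k j : ℝ) : ℂ))
    (stackelU_mul_stackelS x.2.1)
  simp only [Matrix.mul_apply, Matrix.one_apply, Complex.ofReal_sum, Complex.ofReal_mul] at h
  simp only [Matrix.mul_apply, Matrix.one_apply, Matrix.of_apply, map_sum, map_mul, stackelUEl,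
    stackelSEl, coordEl, map_pow, evalAt_realSmooth]
  simp only [stackelU, Complex.ofReal_pow] at h
  rw [h]
  split_ifs <;> simp

lemma partialD_stackelUEl (i k l : Fin n) (h : k ≠ i) :
    partialD (configOpens n m) i (Matrix.of (stackelUEl m) k l) = 0 :=
  partialD_coordEl_pow m h.symm _

lemma partialD_tensorEl (r k : Fin n) :
    partialD (configOpens n m) k (stackelSEl m r k * coordEl m k ^ m)
        + logDensityEl m k * (stackelSEl m r k * coordEl m k ^ m)
      = stackelSEl m r k * (((m : ℂ) / 2) • coordEl m k ^ (m - 1)) := by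
  have hs : ContDiffOn ℝ (⊤ : ℕ∞) (fun x : Fin n → ℝ => stackelS x r k * x k ^ m)
      (configOpens n m) := (contDiffOn_stackelS m r k).mul ((contDiffOn_coord k).pow m)
  have e : stackelSEl m r k * coordEl m k ^ m = realSmooth _ hs := by
    refine smooth_ext_eval fun x => ?_
    simp [stackelSEl, coordEl]
  rw [e, partialD_realSmooth]
  refine smooth_ext_eval fun x => ?_
  have h := pd_eq_of_hasDerivAt (differentiableAt_of_smooth hs x.2) (pd_stackelS_mul x.2 r k)
  simp only [map_add, map_mul, map_smul, map_pow, evalAt_realSmooth, h, logDensityEl, stackelSEl,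
    coordEl, smul_eq_mul]
  push_cast
  ring

variable (n) in
/-- The calculus of differential operators on the configuration space. -/
lemma isCalculus_config : IsCalculus (mulOp (smoothRing (configOpens n m)))
    (conjOp (partialD (configOpens n m)) (logDensityEl m))
    (derivOp (partialD (configOpens n m))) (partialD (configOpens n m)) := by
  have hD : ∀ (i j : Fin n) (f : smoothRing (configOpens n m)),
      partialD (configOpens n m) i (partialD (configOpens n m) j f)
        = partialD (configOpens n m) j (partialD (configOpens n m) i f) :=
    fun i j f => partialD_comm i j f
  refine isCalculus_end hD fun i j => ?_
  simp only [logDensityEl, partialD_realSmooth]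
  refine smooth_ext_eval fun x => ?_
  simp only [evalAt_realSmooth]
  rw [pd_pd_comm contDiffOn_logDensity i j x.2]

/-- `Σ_j w_j A_j`. -/
def quadEl (w : Fin n → ℝ) (k : Fin n) : smoothRing (configOpens n m) :=
  ∑ j, (w j : ℂ) • tensorEl m j k

/-- `Σ_j w_j J_j`. -/
def linEl (w : Fin n → ℝ) (k : Fin n) : smoothRing (configOpens n m) :=
  ∑ j, (w j : ℂ) • fieldEl m j k

/-- `Σ_{j,α} u_{jα} V_j^{(α)}`. -/
def potEl (u : PotentialIndex n m → ℝ) : smoothRing (configOpens n m) :=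
  ∑ p, (u p : ℂ) • potentialEl m p

/-- `ρ⁻¹ ∂_k ρ a_k ∂_k`, summed over `k`. -/
abbrev diagOp (a : Fin n → smoothRing (configOpens n m)) :
    Module.End ℂ (smoothRing (configOpens n m)) :=
  diagonalOp (mulOp _) (conjOp (partialD (configOpens n m)) (logDensityEl m))
    (derivOp (partialD (configOpens n m))) a

/-- `ρ⁻¹ ∂_k ρ X_k + X_k ∂_k`, summed over `k`. -/
abbrev linOp (X : Fin n → smoothRing (configOpens n m)) :
    Module.End ℂ (smoothRing (configOpens n m)) :=
  firstOrderOp (mulOp _) (conjOp (partialD (configOpens n m)) (logDensityEl m))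
    (derivOp (partialD (configOpens n m))) X

/-- The quantum Hamiltonian `Σ_j w_j (Ê_j + Ŵ_j) + Σ_{j,α} u_{jα} V_j^{(α)}`, where `c = -iħ`. -/
def hamOp (c : ℂ) (w : Fin n → ℝ) (u : PotentialIndex n m → ℝ) :
    Module.End ℂ (smoothRing (configOpens n m)) :=
  (c ^ 2 / 2) • diagOp m (quadEl m w) + (c / 2) • linOp m (linEl m w) + mulOp _ (potEl m u)

lemma hamOp_apply (c : ℂ) (w : Fin n → ℝ) (u : PotentialIndex n m → ℝ)
    (f : smoothRing (configOpens n m)) :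
    hamOp m c w u f
      = ∑ j, (w j : ℂ) • ((c ^ 2 / 2) • diagOp m (tensorEl m j) f
          + (c / 2) • linOp m (fieldEl m j) f)
        + ∑ p, (u p : ℂ) • (potentialEl m p * f) := by
  have e1 : diagOp m (quadEl m w) = ∑ j, (w j : ℂ) • diagOp m (tensorEl m j) :=
    diagonalOp_sum_smul _ _ _
  have e2 : linOp m (linEl m w) = ∑ j, (w j : ℂ) • linOp m (fieldEl m j) :=
    firstOrderOp_sum_smul _ _ _
  rw [hamOp, e1, e2]
  simp only [LinearMap.add_apply, LinearMap.smul_apply, LinearMap.sum_apply, mulOp_apply, potEl,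
    Finset.sum_mul, smul_mul_assoc, Finset.smul_sum, smul_add, Finset.sum_add_distrib]
  congr 2
  · exact Finset.sum_congr rfl fun j _ => smul_comm _ _ _
  · exact Finset.sum_congr rfl fun j _ => smul_comm _ _ _

lemma hamOp_sub (c : ℂ) (w w' : Fin n → ℝ) (u u' : PotentialIndex n m → ℝ)
    (f : smoothRing (configOpens n m)) :
    hamOp m c (w - w') (u - u') f = hamOp m c w u f - hamOp m c w' u' f := by
  simp only [hamOp_apply, Pi.sub_apply, Complex.ofReal_sub, sub_smul, Finset.sum_sub_distrib]
  abel

/-- Quantum separability of the quadratic parts: the separated operators are `λ_k^m ∂_k² + (m/2)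
λ_k^{m-1} ∂_k`. -/
lemma opComm_diagOp_tensorEl (p q : Fin n) :
    opComm (diagOp m (tensorEl m p)) (diagOp m (tensorEl m q)) = 0 :=
  diagonalOp_commute (isCalculus_config n m) (fun _ => rfl)
    (U := Matrix.of (stackelUEl m)) (S := Matrix.of (stackelSEl m))
    (f := fun k => coordEl m k ^ m) (g := fun k => ((m : ℂ) / 2) • coordEl m k ^ (m - 1))
    (stackelUEl_mul_stackelSEl m) (partialD_stackelUEl m)
    (fun _ _ h => partialD_coordEl_pow m h _)
    (fun _ _ h => by rw [Derivation.map_smul, partialD_coordEl_pow m h, smul_zero])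
    (partialD_tensorEl m) p q

lemma opComm_diagOp_quadEl (w w' : Fin n → ℝ) :
    opComm (diagOp m (quadEl m w)) (diagOp m (quadEl m w')) = 0 := by
  have e : ∀ w : Fin n → ℝ, diagOp m (quadEl m w) = ∑ j, (w j : ℂ) • diagOp m (tensorEl m j) :=
    fun w => diagonalOp_sum_smul _ _ _
  rw [e, e]
  simp only [sum_opComm, opComm_sum, smul_opComm, opComm_smul, opComm_diagOp_tensorEl, smul_zero,
    Finset.sum_const_zero]

/-- This is what removes the cubic terms of the classical bracket, for arbitrary weights constant in
`λ`. -/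
lemma quadEl_symmetry (w w' : Fin n → ℝ) (i k : Fin n) :
    quadEl m w' i * partialD (configOpens n m) i (quadEl m w k)
      = quadEl m w i * partialD (configOpens n m) i (quadEl m w' k) := by
  have h : ∀ r s, tensorEl m r i * partialD (configOpens n m) i (tensorEl m s k)
      = tensorEl m s i * partialD (configOpens n m) i (tensorEl m r k) := fun r s =>
    diagonal_symmetry (D := partialD (configOpens n m)) (U := Matrix.of (stackelUEl m)) (S := Matrix.of (stackelSEl m))
      (f := fun k => coordEl m k ^ m) (stackelUEl_mul_stackelSEl m) (partialD_stackelUEl m)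
      (fun _ _ h => partialD_coordEl_pow m h m) i k r s
  simp only [quadEl, map_sum, Derivation.map_smul, Finset.sum_mul_sum, smul_mul_smul_comm]
  rw [Finset.sum_comm]
  refine Finset.sum_congr rfl fun r _ => Finset.sum_congr rfl fun s _ => ?_
  rw [h, mul_comm (w' s : ℂ)]

lemma isDivFree_linEl (w : Fin n → ℝ) : IsDivFree (mulOp _)
    (conjOp (partialD (configOpens n m)) (logDensityEl m))
    (derivOp (partialD (configOpens n m))) (linEl m w) := by
  refine isDivFree_end ?_
  have h : ∀ j, ∑ i, (partialD (configOpens n m) i (fieldEl m j i)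
      + logDensityEl m i * fieldEl m j i) = 0 := by
    intro j
    refine smooth_ext_eval fun x => ?_
    have := congrArg (fun s : ℝ => (s : ℂ)) (divergence_fieldJ x.2 (j + 1))
    simpa [fieldEl, logDensityEl, partialD_realSmooth] using this
  simp only [linEl, map_sum, Derivation.map_smul, Finset.mul_sum, mul_smul_comm, ← Finset.sum_add_distrib,
    ← smul_add]
  rw [Finset.sum_comm]
  simp only [← Finset.smul_sum, h, smul_zero, Finset.sum_const_zero]

/-- The second-order coefficients of the Frobenius condition. -/
def secondCoeff (w w' w'' : Fin n → ℝ) (i j : Fin n) : smoothRing (configOpens n m) :=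
  (if i = j then quadEl m w'' i
        + fieldDeriv (partialD (configOpens n m)) (linEl m w') (quadEl m w i)
        - fieldDeriv (partialD (configOpens n m)) (linEl m w) (quadEl m w' i) else 0)
      - (quadEl m w j * partialD (configOpens n m) j (linEl m w' i)
        + quadEl m w i * partialD (configOpens n m) i (linEl m w' j))
      + (quadEl m w' j * partialD (configOpens n m) j (linEl m w i)
        + quadEl m w' i * partialD (configOpens n m) i (linEl m w j))

/-- The first-order coefficients of the Frobenius condition. -/
def firstCoeff (w w' w'' : Fin n → ℝ) (u u' : PotentialIndex n m → ℝ) (i : Fin n) :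
    smoothRing (configOpens n m) :=
  linEl m w'' i + fieldDeriv (partialD (configOpens n m)) (linEl m w') (linEl m w i)
      - fieldDeriv (partialD (configOpens n m)) (linEl m w) (linEl m w' i)
      + quadEl m w' i * partialD (configOpens n m) i (potEl m u)
      - quadEl m w i * partialD (configOpens n m) i (potEl m u')

/-- The zeroth-order coefficient of the Frobenius condition. -/
def zerothCoeff (w w' : Fin n → ℝ) (u u' u'' : PotentialIndex n m → ℝ) :
    smoothRing (configOpens n m) :=
  potEl m u'' + fieldDeriv (partialD (configOpens n m)) (linEl m w') (potEl m u)
    - fieldDeriv (partialD (configOpens n m)) (linEl m w) (potEl m u')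

lemma secondCoeff_symm (w w' w'' : Fin n → ℝ) (i j : Fin n) :
    secondCoeff m w w' w'' i j = secondCoeff m w w' w'' j i := by
  unfold secondCoeff
  by_cases hij : i = j
  · rw [hij]
  · rw [if_neg hij, if_neg (Ne.symm hij)]
    ring

/-- The condition on the coefficients that both Frobenius conditions amount to. -/
def CoefficientCondition (w w' w'' : Fin n → ℝ) (u u' u'' : PotentialIndex n m → ℝ) : Prop :=
  (∀ i j, secondCoeff m w w' w'' i j = 0) ∧ (∀ i, firstCoeff m w w' w'' u u' i = 0) ∧
    zerothCoeff m w w' u u' u'' = 0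

/-- The double-primed weights stand for the difference of the two time derivatives. With `c = -iħ`
the prefactors of the three coefficient groups are nonzero multiples of powers of `ħ`, so `ħ` drops
out. -/
lemma quantum_iff_coefficientCondition {c : ℂ} (hc : c ≠ 0) (w w' w'' : Fin n → ℝ)
    (u u' u'' : PotentialIndex n m → ℝ) :
    -c • hamOp m c w'' u'' + opComm (hamOp m c w u) (hamOp m c w' u') = 0 ↔
      CoefficientCondition m w w' w'' u u' u'' := by
  have h := commutator_formula (isCalculus_config n m) (c₁ := c) (c₂ := c ^ 2 / 2) rfl
    (a := quadEl m w) (a' := quadEl m w') (α := quadEl m w'') (K := linEl m w'')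
    (U := potEl m u) (U' := potEl m u') (V := potEl m u'')
    (isDivFree_linEl m w) (isDivFree_linEl m w') (opComm_diagOp_quadEl m w w')
  have h2 : c ^ 2 / 2 ≠ 0 := div_ne_zero (pow_ne_zero _ hc) two_ne_zero
  rw [hamOp, hamOp, hamOp, h]
  exact operator_eq_zero_iff (isCalculus_config n m) (partialD_coordEl m) hc h2
    (neg_ne_zero.mpr (mul_ne_zero hc h2)) (secondCoeff_symm m w w' w'')

end Hamiltonians

/-! ### Identification of the concrete Hamiltonians with the algebraic ones, and both equivalences
-/

section Frobenius

variable {n m : ℕ}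

/-- Used for time derivatives, real-valued and complex-valued alike: at a fixed phase-space point or
test function, only the weights depend on `t`. -/
lemma pd_sum_smul_add {E κ κ' : Type*} [NormedAddCommGroup E] [NormedSpace ℝ E] [Fintype κ]
    [Fintype κ'] {w : κ → (Fin n → ℝ) → ℝ} {u : κ' → (Fin n → ℝ) → ℝ} {t : Fin n → ℝ}
    (hw : ∀ k, DifferentiableAt ℝ (w k) t) (hu : ∀ k, DifferentiableAt ℝ (u k) t)
    (K : κ → E) (L : κ' → E) (s : Fin n) :
    pd s (fun τ => ∑ k, w k τ • K k + ∑ k, u k τ • L k) t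
      = ∑ k, pd s (w k) t • K k + ∑ k, pd s (u k) t • L k := by
  have h : HasFDerivAt (fun τ => ∑ k, w k τ • K k + ∑ k, u k τ • L k)
      (∑ k, (fderiv ℝ (w k) t).smulRight (K k) + ∑ k, (fderiv ℝ (u k) t).smulRight (L k)) t :=
    (HasFDerivAt.fun_sum fun k _ => (hw k).hasFDerivAt.smul_const (K k)).add
      (HasFDerivAt.fun_sum fun k _ => (hu k).hasFDerivAt.smul_const (L k))
  rw [pd, h.fderiv]
  simp [pd]

/-! ### The quantum Hamiltonians -/

/-- The identity `ρ⁻¹ ∂_k (ρ Φ) = (∂_k + ∂_k log ρ) Φ` links the concrete minimal quantization to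
the operators `δ_k`. Agreement of `G` with `ρ Φ` on `Q` is enough, `Q` being open. -/
lemma conjOp_eq_density {G : (Fin n → ℝ) → ℂ} {Φ : smoothRing (configOpens n m)}
    (h : ∀ z (hz : z ∈ configOpens n m), G z = (density (metricg m) z : ℂ) * evalAt ⟨z, hz⟩ Φ)
    (k : Fin n) {x : Fin n → ℝ} (hx : x ∈ configOpens n m) :
    (((density (metricg m) x)⁻¹ : ℝ) : ℂ) * pd k G x
      = evalAt ⟨x, hx⟩ (conjOp (partialD (configOpens n m)) (logDensityEl m) k Φ) := by
  obtain ⟨F, hF, rfl⟩ := exists_toSmooth Φ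
  have hρ : ContDiffOn ℝ (⊤ : ℕ∞) (fun z : Fin n → ℝ => Real.exp (logDensity m z))
      (configOpens n m) := contDiffOn_logDensity.exp
  have hG : ∀ z ∈ configOpens n m, G z = ((Real.exp (logDensity m z) : ℝ) : ℂ) * F z := by
    intro z hz
    rw [h z hz, density_eq hz, evalAt_toSmooth]
  have hpd : pd k (fun z : Fin n → ℝ => ((Real.exp (logDensity m z) : ℝ) : ℂ)) x
      = ((Real.exp (logDensity m x) * pd k (logDensity m) x : ℝ) : ℂ) := by
    have hd := differentiableAt_of_smooth hρ hx
    have hl := differentiableAt_of_smooth (contDiffOn_logDensity (n := n) (m := m)) hx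
    rw [pd_ofReal hd]
    congr 1
    rw [pd, (hl.hasFDerivAt.exp).fderiv]
    rfl
  have e : pd k G x = evalAt ⟨x, hx⟩ (partialD (configOpens n m) k
      (realSmooth _ hρ * toSmooth F hF)) := by
    rw [pd_congr hG k hx, realSmooth, toSmooth_mul, partialD_toSmooth, evalAt_toSmooth]
  have e2 : evalAt ⟨x, hx⟩ (partialD (configOpens n m) k (realSmooth _ hρ))
      = ((Real.exp (logDensity m x) * pd k (logDensity m) x : ℝ) : ℂ) := by
    rw [realSmooth, partialD_toSmooth, evalAt_toSmooth, hpd]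
  rw [e, Derivation.leibniz, density_eq hx]
  simp only [smul_eq_mul, map_add, map_mul, e2, conjOp_apply, logDensityEl, evalAt_realSmooth,
    evalAt_toSmooth]
  have hne : ((Real.exp (logDensity m x) : ℝ) : ℂ) ≠ 0 :=
    Complex.ofReal_ne_zero.mpr (Real.exp_ne_zero _)
  rw [Complex.ofReal_inv, Complex.ofReal_mul]
  field_simp

lemma evalAt_tensorEl (j k : Fin n) {x : Fin n → ℝ} (hx : x ∈ configOpens n m) :
    evalAt ⟨x, hx⟩ (tensorEl m j k) = ((stackelS x j k * x k ^ m : ℝ) : ℂ) := by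
  simp [tensorEl, stackelSEl, coordEl]

lemma tensorA_apply (j i k : Fin n) (x : Fin n → ℝ) :
    tensorA m (j + 1) x i k = if i = k then stackelS x j k * x k ^ m else 0 := by
  rw [tensorA, Matrix.diagonal_apply]
  split_ifs with h
  · subst h
    rw [stackelS]
    ring
  · rfl

lemma hAhat_eq (ħ : ℝ) (c : ℤ → (Fin n → ℝ) → ℝ) (t : Fin n → ℝ) (j : Fin n)
    {F : (Fin n → ℝ) → ℂ} (hF : ContDiffOn ℝ (⊤ : ℕ∞) F (configOpens n m)) {x : Fin n → ℝ}
    (hx : x ∈ configOpens n m) :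
    hAhat ħ m c t (j + 1) F x = evalAt ⟨x, hx⟩
      (((-Complex.I * ħ) ^ 2 / 2) • diagOp m (tensorEl m j) (toSmooth F hF)
          + (-Complex.I * ħ / 2) • linOp m (fieldEl m j) (toSmooth F hF))
      + ∑ α : Finset.Icc (-(m : ℤ)) (2 * (n : ℤ) - m + 2),
          (c α t : ℂ) * evalAt ⟨x, hx⟩ (potentialEl m (j, α) * toSmooth F hF) := by
  have hq : (((density (metricg m) x)⁻¹ : ℝ) : ℂ) * ∑ k : Fin n, pd k (fun z =>
        ∑ i : Fin n, ((density (metricg m) z * tensorA m (j + 1) z k i : ℝ) : ℂ) * pd i F z) x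
      = evalAt ⟨x, hx⟩ (diagOp m (tensorEl m j) (toSmooth F hF)) := by
    rw [Finset.mul_sum, diagOp, diagonalOp, LinearMap.sum_apply, map_sum]
    refine Finset.sum_congr rfl fun k _ => ?_
    simp only [Module.End.mul_apply]
    refine conjOp_eq_density (fun z hz => ?_) k hx
    rw [Finset.sum_eq_single k]
    · rw [tensorA_apply, if_pos rfl, mulOp_apply, derivOp_apply, map_mul, evalAt_tensorEl,
        partialD_toSmooth, evalAt_toSmooth]
      push_cast
      ring
    · intro i _ hi
      rw [tensorA_apply, if_neg (Ne.symm hi)]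
      simp
    · simp
  have hl : (((density (metricg m) x)⁻¹ : ℝ) : ℂ) * ∑ k : Fin n, pd k (fun z =>
        ((density (metricg m) z * fieldJ m (j + 1) z k : ℝ) : ℂ) * F z) x
        + ∑ k : Fin n, ((fieldJ m (j + 1) x k : ℝ) : ℂ) * pd k F x
      = evalAt ⟨x, hx⟩ (linOp m (fieldEl m j) (toSmooth F hF)) := by
    rw [Finset.mul_sum, linOp, firstOrderOp, LinearMap.sum_apply, map_sum, ← Finset.sum_add_distrib]
    refine Finset.sum_congr rfl fun k _ => ?_
    simp only [Module.End.mul_apply, LinearMap.add_apply, map_add]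
    congr 1
    · refine conjOp_eq_density (fun z hz => ?_) k hx
      rw [mulOp_apply, map_mul, fieldEl, evalAt_realSmooth, evalAt_toSmooth]
      push_cast
      ring
    · rw [mulOp_apply, map_mul, fieldEl, evalAt_realSmooth, derivOp_apply, partialD_toSmooth,
        evalAt_toSmooth]
  have hp : ((∑ α ∈ Finset.Icc (-(m : ℤ)) (2 * (n : ℤ) - m + 2), c α t * potV (j + 1) α x : ℝ) : ℂ)
        * F x
      = ∑ α : Finset.Icc (-(m : ℤ)) (2 * (n : ℤ) - m + 2),
          (c α t : ℂ) * evalAt ⟨x, hx⟩ (potentialEl m (j, α) * toSmooth F hF) := by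
    rw [← Finset.sum_coe_sort, Complex.ofReal_sum, Finset.sum_mul]
    refine Finset.sum_congr rfl fun α _ => ?_
    rw [map_mul, potentialEl, evalAt_realSmooth, evalAt_toSmooth]
    push_cast
    ring
  rw [hAhat, hp, quantQuadratic, quantLinear, hl, mul_assoc, hq, map_add, map_smul, map_smul,
    smul_eq_mul, smul_eq_mul]
  congr 1
  -- With `c = -iħ` one has `c²/2 = -ħ²/2`, the prefactor of the quantized quadratic part.
  linear_combination (-(ħ : ℂ) ^ 2 / 2 * evalAt ⟨x, hx⟩ (diagOp m (tensorEl m j) (toSmooth F hF)))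
    * Complex.I_sq

/-- The coefficients of `h_j` in `H_r`. -/
def weight (m : ℕ) (ζ : ℕ → ℕ → (Fin n → ℝ) → ℝ) (r j : Fin n) : (Fin n → ℝ) → ℝ :=
  zetaMatrix m ζ (r + 1) (j + 1)

/-- The coefficients of `V_j^{(α)}` in `H_r`. -/
def potentialWeight (m : ℕ) (ζ : ℕ → ℕ → (Fin n → ℝ) → ℝ) (c : ℤ → (Fin n → ℝ) → ℝ) (r : Fin n)
    (p : PotentialIndex n m) (t : Fin n → ℝ) : ℝ :=
  weight m ζ r p.1 t * c p.2 t

lemma HAhat_eq (ħ : ℝ) (c : ℤ → (Fin n → ℝ) → ℝ) (ζ : ℕ → ℕ → (Fin n → ℝ) → ℝ) (r : Fin n)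
    (t : Fin n → ℝ) {F : (Fin n → ℝ) → ℂ} (hF : ContDiffOn ℝ (⊤ : ℕ∞) F (configOpens n m))
    {x : Fin n → ℝ} (hx : x ∈ configOpens n m) :
    HAhat ħ m c ζ (r + 1) t F x = evalAt ⟨x, hx⟩ (hamOp m (-Complex.I * ħ)
      (fun j => weight m ζ r j t) (fun p => potentialWeight m ζ c r p t) (toSmooth F hF)) := by
  rw [HAhat, combine_eq, Finset.sum_apply, Finset.sum_apply, hamOp_apply, map_add, map_sum, map_sum,
    Fintype.sum_prod_type, ← Finset.sum_add_distrib]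
  refine Finset.sum_congr rfl fun j _ => ?_
  rw [Pi.smul_apply, Pi.smul_apply, hAhat_eq ħ c t j hF hx, Complex.real_smul, mul_add,
    Finset.mul_sum, map_smul, smul_eq_mul]
  congr 1
  refine Finset.sum_congr rfl fun α _ => ?_
  rw [map_smul, smul_eq_mul, ← mul_assoc, potentialWeight, Complex.ofReal_mul]
  rfl

/-- Makes compositions meaningful in the ring: the image of a test function is again smooth on `Q`,
hence a legitimate argument for the next Hamiltonian. -/
lemma contDiffOn_HAhat (ħ : ℝ) (c : ℤ → (Fin n → ℝ) → ℝ) (ζ : ℕ → ℕ → (Fin n → ℝ) → ℝ)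
    (r : Fin n) (t : Fin n → ℝ) {F : (Fin n → ℝ) → ℂ}
    (hF : ContDiffOn ℝ (⊤ : ℕ∞) F (configOpens n m)) :
    ∃ h : ContDiffOn ℝ (⊤ : ℕ∞) (HAhat ħ m c ζ (r + 1) t F) (configOpens n m),
      toSmooth _ h = hamOp m (-Complex.I * ħ) (fun j => weight m ζ r j t)
        (fun p => potentialWeight m ζ c r p t) (toSmooth F hF) := by
  obtain ⟨G, hG, e⟩ := exists_toSmooth (hamOp m (-Complex.I * ħ) (fun j => weight m ζ r j t)
        (fun p => potentialWeight m ζ c r p t) (toSmooth F hF))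
  have h : ∀ x ∈ configOpens n m, HAhat ħ m c ζ (r + 1) t F x = G x := by
    intro x hx
    rw [HAhat_eq ħ c ζ r t hF hx, e, evalAt_toSmooth]
  exact ⟨hG.congr h, by rw [e]; exact toSmooth_congr h⟩

lemma pd_HAhat (ħ : ℝ) (c : ℤ → (Fin n → ℝ) → ℝ) (ζ : ℕ → ℕ → (Fin n → ℝ) → ℝ) (r s : Fin n)
    {t : Fin n → ℝ} (hw : ∀ j, DifferentiableAt ℝ (weight m ζ r j) t)
    (hu : ∀ p, DifferentiableAt ℝ (potentialWeight m ζ c r p) t)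
    {F : (Fin n → ℝ) → ℂ} (hF : ContDiffOn ℝ (⊤ : ℕ∞) F (configOpens n m))
    {x : Fin n → ℝ} (hx : x ∈ configOpens n m) :
    pd s (fun τ => HAhat ħ m c ζ (r + 1) τ F x) t
      = evalAt ⟨x, hx⟩ (hamOp m (-Complex.I * ħ) (fun j => pd s (weight m ζ r j) t)
        (fun p => pd s (potentialWeight m ζ c r p) t) (toSmooth F hF)) := by
  have e : ∀ (w : Fin n → ℝ) (u : PotentialIndex n m → ℝ),
      evalAt ⟨x, hx⟩ (hamOp m (-Complex.I * ħ) w u (toSmooth F hF))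
      = ∑ j, w j • evalAt ⟨x, hx⟩ (((-Complex.I * ħ) ^ 2 / 2) • diagOp m (tensorEl m j)
            (toSmooth F hF) + (-Complex.I * ħ / 2) • linOp m (fieldEl m j) (toSmooth F hF))
        + ∑ p, u p • evalAt ⟨x, hx⟩ (potentialEl m p * toSmooth F hF) := by
    intro w u
    rw [hamOp_apply, map_add, map_sum, map_sum]
    refine congrArg₂ (· + ·) (Finset.sum_congr rfl fun j _ => ?_)
      (Finset.sum_congr rfl fun j _ => ?_) <;> rw [map_smul, smul_eq_mul, Complex.real_smul]
  simp only [HAhat_eq ħ c ζ r _ hF hx, e]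
  exact pd_sum_smul_add hw hu _ _ s

/-! ### The classical Hamiltonians -/

/-- The coefficient of `½ μ_k²` in `Σ_j w_j h_j`. -/
def quadCoeff (m : ℕ) (w : Fin n → ℝ) (x : Fin n → ℝ) (k : Fin n) : ℝ :=
  ∑ j, w j * (stackelS x j k * x k ^ m)

/-- The coefficient of `μ_k` in `Σ_j w_j h_j`. -/
def linCoeff (m : ℕ) (w : Fin n → ℝ) (x : Fin n → ℝ) (k : Fin n) : ℝ :=
  ∑ j : Fin n, w j * fieldJ m (j + 1) x k

/-- The potential `Σ_{j,α} u_{jα} V_j^{(α)}`. -/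
def potCoeff (u : PotentialIndex n m → ℝ) (x : Fin n → ℝ) : ℝ :=
  ∑ p, u p * potV (p.1 + 1) p.2 x

/-- The classical Hamiltonian `Σ_j w_j (E_j + W_j) + Σ_{j,α} u_{jα} V_j^{(α)}`. -/
def classicalH (w : Fin n → ℝ) (u : PotentialIndex n m → ℝ) (x y : Fin n → ℝ) : ℝ :=
  (1 / 2) * ∑ k, quadCoeff m w x k * y k ^ 2 + ∑ k, linCoeff m w x k * y k + potCoeff u x

lemma classicalH_eq (w : Fin n → ℝ) (u : PotentialIndex n m → ℝ) (x y : Fin n → ℝ) :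
    classicalH w u x y = ∑ j, w j • ((1 / 2) * ∑ k, stackelS x j k * x k ^ m * y k ^ 2
        + ∑ k, fieldJ m (j + 1) x k * y k) + ∑ p, u p • potV (p.1 + 1) p.2 x := by
  simp only [classicalH, quadCoeff, linCoeff, potCoeff, smul_eq_mul, mul_add, Finset.sum_add_distrib,
    Finset.sum_mul, Finset.mul_sum]
  congr 2
  · rw [Finset.sum_comm]
    exact Finset.sum_congr rfl fun j _ => Finset.sum_congr rfl fun k _ => by ring
  · rw [Finset.sum_comm]
    exact Finset.sum_congr rfl fun j _ => Finset.sum_congr rfl fun k _ => by ring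

lemma HA_eq (c : ℤ → (Fin n → ℝ) → ℝ) (ζ : ℕ → ℕ → (Fin n → ℝ) → ℝ) (r : Fin n)
    (t : Fin n → ℝ) : HA m c ζ (r + 1) t = classicalH
      (fun j => weight m ζ r j t) (fun p : PotentialIndex n m => potentialWeight m ζ c r p t) := by
  ext x y
  rw [HA, combine_eq, Finset.sum_apply, Finset.sum_apply, classicalH_eq, Fintype.sum_prod_type,
    ← Finset.sum_add_distrib]
  refine Finset.sum_congr rfl fun j _ => ?_
  have hq : ∑ i : Fin n, ∑ k : Fin n, tensorA m (j + 1) x i k * y i * y k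
      = ∑ k, stackelS x j k * x k ^ m * y k ^ 2 := by
    refine Finset.sum_congr rfl fun i _ => ?_
    rw [Finset.sum_eq_single i]
    · rw [tensorA_apply, if_pos rfl]
      ring
    · intro k _ hk
      rw [tensorA_apply, if_neg hk.symm]
      ring
    · simp
  have hp := Finset.sum_coe_sort (Finset.Icc (-(m : ℤ)) (2 * (n : ℤ) - m + 2))
    fun α => c α t * potV (j + 1) α x
  rw [Pi.smul_apply, Pi.smul_apply, hA, hq, smul_add, ← hp, Finset.smul_sum]
  refine congrArg₂ (· + ·) rfl (Finset.sum_congr rfl fun α _ => ?_)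
  simp only [potentialWeight, weight, smul_eq_mul]
  ring

lemma pd_HA (c : ℤ → (Fin n → ℝ) → ℝ) (ζ : ℕ → ℕ → (Fin n → ℝ) → ℝ) (r s : Fin n)
    {t : Fin n → ℝ} (hw : ∀ j, DifferentiableAt ℝ (weight m ζ r j) t)
    (hu : ∀ p, DifferentiableAt ℝ (potentialWeight m ζ c r p) t) (x y : Fin n → ℝ) :
    pd s (fun τ => HA m c ζ (r + 1) τ x y) t = classicalH (fun j => pd s (weight m ζ r j) t)
      (fun p : PotentialIndex n m => pd s (potentialWeight m ζ c r p) t) x y := by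
  simp only [HA_eq, classicalH_eq]
  exact pd_sum_smul_add hw hu _ _ s

lemma classicalH_sub (w w' : Fin n → ℝ) (u u' : PotentialIndex n m → ℝ) (x y : Fin n → ℝ) :
    classicalH (w - w') (u - u') x y = classicalH w u x y - classicalH w' u' x y := by
  simp only [classicalH_eq, Pi.sub_apply, sub_smul, Finset.sum_sub_distrib]
  ring

lemma contDiffOn_quadCoeff (w : Fin n → ℝ) (k : Fin n) :
    ContDiffOn ℝ (⊤ : ℕ∞) (fun x => quadCoeff m w x k) (configOpens n m) :=
  ContDiffOn.sum fun j _ => contDiffOn_const.mul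
    ((contDiffOn_stackelS m j k).mul ((contDiffOn_coord k).pow m))

lemma contDiffOn_linCoeff (w : Fin n → ℝ) (k : Fin n) :
    ContDiffOn ℝ (⊤ : ℕ∞) (fun x => linCoeff m w x k) (configOpens n m) :=
  ContDiffOn.sum fun _ _ => contDiffOn_const.mul (contDiffOn_fieldJ m _ k)

lemma contDiffOn_potCoeff (u : PotentialIndex n m → ℝ) :
    ContDiffOn ℝ (⊤ : ℕ∞) (potCoeff u) (configOpens n m) :=
  ContDiffOn.sum fun p _ => contDiffOn_const.mul (contDiffOn_potV p.2.2 _)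

lemma quadEl_eq (w : Fin n → ℝ) (k : Fin n) :
    quadEl m w k = realSmooth _ (contDiffOn_quadCoeff w k) := by
  refine smooth_ext_eval fun x => ?_
  simp only [quadEl, quadCoeff, map_sum, map_smul, smul_eq_mul, evalAt_realSmooth,
    Complex.ofReal_sum, Complex.ofReal_mul]
  exact Finset.sum_congr rfl fun j _ => by rw [evalAt_tensorEl, Complex.ofReal_mul]

lemma linEl_eq (w : Fin n → ℝ) (k : Fin n) :
    linEl m w k = realSmooth _ (contDiffOn_linCoeff w k) := by
  refine smooth_ext_eval fun x => ?_
  simp only [linEl, linCoeff, fieldEl, map_sum, map_smul, smul_eq_mul, evalAt_realSmooth,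
    Complex.ofReal_sum, Complex.ofReal_mul]

lemma potEl_eq (u : PotentialIndex n m → ℝ) :
    potEl m u = realSmooth _ (contDiffOn_potCoeff u) := by
  refine smooth_ext_eval fun x => ?_
  simp only [potEl, potCoeff, potentialEl, map_sum, map_smul, evalAt_realSmooth,
    Complex.ofReal_sum, Complex.ofReal_mul, smul_eq_mul]

/-- The real derivatives are expressed through the complex ring and its derivations so that the
classical coefficients become literally the quantum ones. -/
lemma pd_classicalH_position (w : Fin n → ℝ) (u : PotentialIndex n m → ℝ) (y : Fin n → ℝ)
    (i : Fin n) {x : Fin n → ℝ} (hx : x ∈ configOpens n m) :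
    ((pd i (fun z => classicalH w u z y) x : ℝ) : ℂ)
      = (1 / 2) * ∑ k, evalAt ⟨x, hx⟩ (partialD (configOpens n m) i (quadEl m w k)) * (y k : ℂ) ^ 2
        + ∑ k, evalAt ⟨x, hx⟩ (partialD (configOpens n m) i (linEl m w k)) * (y k : ℂ)
        + evalAt ⟨x, hx⟩ (partialD (configOpens n m) i (potEl m u)) := by
  have hs : ContDiffOn ℝ (⊤ : ℕ∞) (fun z => classicalH w u z y) (configOpens n m) :=
    ((contDiffOn_const.mul (ContDiffOn.sum fun k _ =>
      (contDiffOn_quadCoeff w k).mul contDiffOn_const)).add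
      (ContDiffOn.sum fun k _ => (contDiffOn_linCoeff w k).mul contDiffOn_const)).add
      (contDiffOn_potCoeff u)
  have e : realSmooth _ hs = (1 / 2 : ℂ) • ∑ k, ((y k : ℂ) ^ 2) • quadEl m w k
      + ∑ k, (y k : ℂ) • linEl m w k + potEl m u := by
    refine smooth_ext_eval fun z => ?_
    simp only [quadEl_eq, linEl_eq, potEl_eq, map_add, map_smul, map_sum, evalAt_realSmooth,
      smul_eq_mul, classicalH]
    push_cast
    simp only [mul_comm]
  have h := congrArg (fun f => evalAt ⟨x, hx⟩ (partialD (configOpens n m) i f)) e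
  simp only [partialD_realSmooth, evalAt_realSmooth] at h
  rw [h]
  simp only [map_add, map_sum, Derivation.map_smul, map_smul, smul_eq_mul]
  simp only [mul_comm]

lemma pd_classicalH_momentum (w : Fin n → ℝ) (u : PotentialIndex n m → ℝ) (x y : Fin n → ℝ)
    (i : Fin n) : pd i (classicalH w u x) y = quadCoeff m w x i * y i + linCoeff m w x i := by
  have hd : DifferentiableAt ℝ (classicalH w u x) y := by
    unfold classicalH
    fun_prop
  refine pd_eq_of_hasDerivAt hd ?_
  have h : HasDerivAt (fun s => classicalH w u x (Function.update y i s)) _ (y i) :=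
    (((HasDerivAt.fun_sum (u := Finset.univ) fun k _ =>
      ((hasDerivAt_update_coord y i k).pow 2).const_mul (quadCoeff m w x k)).const_mul (1 / 2)).add
      (HasDerivAt.fun_sum (u := Finset.univ) fun k _ =>
        (hasDerivAt_update_coord y i k).const_mul (linCoeff m w x k))).add_const (potCoeff u x)
  refine h.congr_deriv ?_
  simp
  ring

/-- At each point of `Q` the left side is a polynomial in the momenta, quadratic after the cubic
terms cancel, and its coefficients are the values there of the three coefficient groups. -/
lemma classical_iff_coefficientCondition (w w' w'' : Fin n → ℝ)
    (u u' u'' : PotentialIndex n m → ℝ) :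
    (∀ x ∈ configSpace n m, ∀ y,
      classicalH w'' u'' x y + poisson (classicalH w u) (classicalH w' u') x y = 0) ↔
      CoefficientCondition m w w' w'' u u' u'' := by
  have key : ∀ x (hx : x ∈ configOpens n m),
      (∀ y, classicalH w'' u'' x y + poisson (classicalH w u) (classicalH w' u') x y = 0) ↔
        (∀ i j, evalAt ⟨x, hx⟩ (secondCoeff m w w' w'' i j) = 0) ∧
        (∀ i, evalAt ⟨x, hx⟩ (firstCoeff m w w' w'' u u' i) = 0) ∧
        evalAt ⟨x, hx⟩ (zerothCoeff m w w' u u' u'') = 0 := by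
    intro x hx
    have hc := fun i k => congrArg (evalAt ⟨x, hx⟩) (quadEl_symmetry m w w' i k)
    simp only [map_mul] at hc
    refine Iff.trans (forall_congr' fun y => ?_) (quadratic_eq_zero_iff fun i j => by
      rw [secondCoeff_symm])
    have h1 : ((classicalH w'' u'' x y : ℝ) : ℂ)
        = (1 / 2) * ∑ k, evalAt ⟨x, hx⟩ (quadEl m w'' k) * (y k : ℂ) ^ 2
          + ∑ k, evalAt ⟨x, hx⟩ (linEl m w'' k) * (y k : ℂ) + evalAt ⟨x, hx⟩ (potEl m u'') := by
      simp only [quadEl_eq, linEl_eq, potEl_eq, evalAt_realSmooth, classicalH]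
      push_cast
      rfl
    have h2 : ∀ (w : Fin n → ℝ) (u : PotentialIndex n m → ℝ) i,
        ((pd i (classicalH w u x) y : ℝ) : ℂ)
        = evalAt ⟨x, hx⟩ (quadEl m w i) * (y i : ℂ) + evalAt ⟨x, hx⟩ (linEl m w i) := by
      intro w u i
      rw [pd_classicalH_momentum, quadEl_eq, linEl_eq]
      simp only [evalAt_realSmooth]
      push_cast
      rfl
    rw [← Complex.ofReal_eq_zero, poisson]
    push_cast
    simp only [h1, h2, pd_classicalH_position _ _ y _ hx]
    rw [poisson_expansion hc fun k => (y k : ℂ)]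
    simp only [secondCoeff, firstCoeff, zerothCoeff, fieldDeriv, map_add, map_sub, map_mul, map_sum,
      apply_ite (evalAt ⟨x, hx⟩), map_zero]
  have e0 : ∀ f : smoothRing (configOpens n m),
      f = 0 ↔ ∀ x (hx : x ∈ configOpens n m), evalAt ⟨x, hx⟩ f = 0 := fun f =>
    ⟨fun h x hx => by rw [h, map_zero], fun h => smooth_ext_eval fun x => by rw [h x.1 x.2, map_zero]⟩
  refine (forall_congr' fun x => forall_congr' fun hx => key x hx).trans ?_
  simp only [CoefficientCondition, e0]
  exact ⟨fun h => ⟨fun i j x hx => (h x hx).1 i j, fun i x hx => (h x hx).2.1 i,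
    fun x hx => (h x hx).2.2⟩, fun h x hx => ⟨fun i j => h.1 i j x hx, fun i => h.2.1 i x hx,
    h.2.2 x hx⟩⟩

lemma differentiableAt_weight (hm : m ≤ n + 1) {T : Set (Fin n → ℝ)} (hT : IsOpen T)
    {ζ : ℕ → ℕ → (Fin n → ℝ) → ℝ} (hζ : ZetaAdmissible m T ζ) (r j : Fin n) {t : Fin n → ℝ}
    (ht : t ∈ T) : DifferentiableAt ℝ (weight m ζ r j) t :=
  differentiableAt_zetaMatrix hm hT hζ r j ht

lemma differentiableAt_potentialWeight (hm : m ≤ n + 1) {T : Set (Fin n → ℝ)} (hT : IsOpen T)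
    {ζ : ℕ → ℕ → (Fin n → ℝ) → ℝ} (hζ : ZetaAdmissible m T ζ) {c : ℤ → (Fin n → ℝ) → ℝ}
    (hc : ∀ α ∈ Finset.Icc (-(m : ℤ)) (2 * (n : ℤ) - m + 2), ContDiffOn ℝ (⊤ : ℕ∞) (c α) T)
    (r : Fin n) (p : PotentialIndex n m) {t : Fin n → ℝ} (ht : t ∈ T) :
    DifferentiableAt ℝ (potentialWeight m ζ c r p) t :=
  (differentiableAt_weight hm hT hζ r p.1 ht).mul
    (((hc p.2 p.2.2).contDiffAt (hT.mem_nhds ht)).differentiableAt (by simp))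

/-- The condition on the coefficients for the Hamiltonians with the labels `r` and `s`. -/
def FrobeniusCondition (m : ℕ) (c : ℤ → (Fin n → ℝ) → ℝ) (ζ : ℕ → ℕ → (Fin n → ℝ) → ℝ)
    (r s : Fin n) (t : Fin n → ℝ) : Prop :=
  CoefficientCondition m (fun j => weight m ζ r j t) (fun j => weight m ζ s j t)
    ((fun j => pd s (weight m ζ r j) t) - fun j => pd r (weight m ζ s j) t)
    (fun p => potentialWeight m ζ c r p t) (fun p => potentialWeight m ζ c s p t)
    ((fun p => pd s (potentialWeight m ζ c r p) t) - fun p => pd r (potentialWeight m ζ c s p) t)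

lemma classicalFrobenius_iff {T : Set (Fin n → ℝ)} {c : ℤ → (Fin n → ℝ) → ℝ}
    {ζ : ℕ → ℕ → (Fin n → ℝ) → ℝ}
    (hw : ∀ r j, ∀ t ∈ T, DifferentiableAt ℝ (weight m ζ r j) t)
    (hu : ∀ r (p : PotentialIndex n m), ∀ t ∈ T, DifferentiableAt ℝ (potentialWeight m ζ c r p) t) :
    ClassicalFrobenius T (configSpace n m) (HA m c ζ) ↔
      ∀ r s, ∀ t ∈ T, FrobeniusCondition m c ζ r s t := by
  refine forall_congr' fun r => forall_congr' fun s => forall₂_congr fun t ht => ?_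
  refine Iff.trans ?_ (classical_iff_coefficientCondition _ _ _ _ _ _)
  refine forall₂_congr fun x _ => forall_congr' fun y => ?_
  rw [pd_HA c ζ r s (fun j => hw r j t ht) (fun p => hu r p t ht),
    pd_HA c ζ s r (fun j => hw s j t ht) (fun p => hu s p t ht), HA_eq, HA_eq, classicalH_sub]

/-- Up to their irrelevant values off `Q`, the test functions are exactly the elements of
`smoothRing`; quantifying over them and over the points of `Q` therefore gives one equation between
endomorphisms. -/
lemma quantumFrobenius_iff {ħ : ℝ} (hħ : ħ ≠ 0) {T : Set (Fin n → ℝ)} {c : ℤ → (Fin n → ℝ) → ℝ}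
    {ζ : ℕ → ℕ → (Fin n → ℝ) → ℝ}
    (hw : ∀ r j, ∀ t ∈ T, DifferentiableAt ℝ (weight m ζ r j) t)
    (hu : ∀ r (p : PotentialIndex n m), ∀ t ∈ T, DifferentiableAt ℝ (potentialWeight m ζ c r p) t) :
    QuantumFrobenius ħ T (configSpace n m) (HAhat ħ m c ζ) ↔
      ∀ r s, ∀ t ∈ T, FrobeniusCondition m c ζ r s t := by
  refine forall_congr' fun r => forall_congr' fun s => forall₂_congr fun t ht => ?_
  have hc : -Complex.I * (ħ : ℂ) ≠ 0 :=
    mul_ne_zero (neg_ne_zero.mpr Complex.I_ne_zero) (Complex.ofReal_ne_zero.mpr hħ)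
  refine Iff.trans ?_ (quantum_iff_coefficientCondition m hc _ _ _ _ _ _)
  have key : ∀ (F : (Fin n → ℝ) → ℂ) (hF : ContDiffOn ℝ (⊤ : ℕ∞) F (configOpens n m))
      (x : Fin n → ℝ) (hx : x ∈ configOpens n m),
      Complex.I * (ħ : ℂ) * pd s (fun τ => HAhat ħ m c ζ (r + 1) τ F x) t
      - Complex.I * (ħ : ℂ) * pd r (fun τ => HAhat ħ m c ζ (s + 1) τ F x) t
      + (HAhat ħ m c ζ (r + 1) t (HAhat ħ m c ζ (s + 1) t F) x
        - HAhat ħ m c ζ (s + 1) t (HAhat ħ m c ζ (r + 1) t F) x)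
      = evalAt ⟨x, hx⟩ ((-(-Complex.I * (ħ : ℂ)) • hamOp m (-Complex.I * ħ)
            ((fun j => pd s (weight m ζ r j) t) - fun j => pd r (weight m ζ s j) t)
            ((fun p => pd s (potentialWeight m ζ c r p) t)
              - fun p => pd r (potentialWeight m ζ c s p) t)
          + opComm (hamOp m (-Complex.I * ħ) (fun j => weight m ζ r j t)
              fun p => potentialWeight m ζ c r p t)
            (hamOp m (-Complex.I * ħ) (fun j => weight m ζ s j t)
              fun p => potentialWeight m ζ c s p t)) (toSmooth F hF)) := by
    intro F hF x hx
    obtain ⟨hr, er⟩ := contDiffOn_HAhat ħ c ζ r t hF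
    obtain ⟨hs, es⟩ := contDiffOn_HAhat ħ c ζ s t hF
    rw [pd_HAhat ħ c ζ r s (fun j => hw r j t ht) (fun p => hu r p t ht) hF hx,
      pd_HAhat ħ c ζ s r (fun j => hw s j t ht) (fun p => hu s p t ht) hF hx,
      HAhat_eq ħ c ζ r t hs hx, HAhat_eq ħ c ζ s t hr hx, er, es]
    simp only [LinearMap.add_apply, LinearMap.smul_apply, hamOp_sub, opComm, LinearMap.sub_apply,
      Module.End.mul_apply, map_add, map_sub, map_smul, smul_eq_mul]
    ring
  constructor
  · intro h
    refine LinearMap.ext fun f => ?_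
    obtain ⟨F, hF, rfl⟩ := exists_toSmooth f
    refine smooth_ext_eval fun x => ?_
    rw [← key F hF x.1 x.2, LinearMap.zero_apply, map_zero]
    exact h F hF x.1 x.2
  · intro h F hF x hx
    rw [key F hF x hx, h, LinearMap.zero_apply, map_zero]

end Frobenius

end QuasiStackel

end

theorem theorem1 (n m : ℕ) (hm : m ≤ n + 1) (ħ : ℝ) (hħ : 0 < ħ)
    (T : Set (Fin n → ℝ)) (hT : IsOpen T)
    (c : ℤ → (Fin n → ℝ) → ℝ)
    (hc : ∀ α ∈ Finset.Icc (-(m : ℤ)) (2 * (n : ℤ) - m + 2), ContDiffOn ℝ (⊤ : ℕ∞) (c α) T)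
    (ζ : ℕ → ℕ → (Fin n → ℝ) → ℝ) (hζ : ZetaAdmissible m T ζ) :
    ClassicalFrobenius T (configSpace n m) (HA m c ζ) ↔
      QuantumFrobenius ħ T (configSpace n m) (HAhat ħ m c ζ) := by
  have hw : ∀ r j, ∀ t ∈ T, DifferentiableAt ℝ (weight m ζ r j) t := fun r j t ht =>
    differentiableAt_weight hm hT hζ r j ht
  have hu : ∀ r (p : PotentialIndex n m), ∀ t ∈ T,
      DifferentiableAt ℝ (potentialWeight m ζ c r p) t := fun r p t ht =>
    differentiableAt_potentialWeight hm hT hζ hc r p ht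
  rw [classicalFrobenius_iff hw hu, quantumFrobenius_iff hħ.ne' hw hu]
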